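/- Let $\mathcal C$ be a Frobenius exact category, that is, an exact category (in the sense of Quillen) with enough projectives and enough injectives in which projective and injective objects coincide. Let $\mathcal P$ be the full subcategory of projective objects, and let $\underline{\mathcal C}$ be the stable category of $\mathcal C$ modulo projectives, with its usual triangulated structure and suspension $[1]=\Omega^{-1}$. All full subcategories of $\underline{\mathcal C}$ are understood to be closed under isomorphism. For a class $\mathcal S$ of objects of $\mathcal C$, let $\underline{\mathcal S}$ denote its essential image in $\underline{\mathcal C}$, let $\Omega\mathcal S$ be the class of all kernels of deflations $P\to S$ with $S\in\mathcal S$ and $P$ projective, and let $\Omega^{-1}\mathcal S$ be the class of all cokernels of inflations $S\to I$ with $S\in\mathcal S$ and $I$ injective. A pair $(\mathcal F,\mathcal T)$ of classes of objects of $\mathcal C$ is a cotorsion pair if $\mathcal T=\{Y:\operatorname{Ext}^1_{\mathcal C}(F,Y)=0\ \forall F\in\mathcal F\}$ and $\mathcal F=\{X:\operatorname{Ext}^1_{\mathcal C}(X,T)=0\ \forall T\in\mathcal T\}$. It is complete if every $M\in\mathcal C$ admits conflations $0\to T\to F\to M\to0$ and $0\to M\to T'\to F'\to 0$ with $F,F'\in\mathcal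 F$ and $T,T'\in\mathcal T$. It is hereditary if $\Omega\mathcal F\subseteq\mathcal F$, and cohereditary if $\Omega^{-1}\mathcal F\subseteq\mathcal F$. A pair $(\mathcal U,\mathcal V)$ of full subcategories of $\underline{\mathcal C}$ is a t-structure if (i) $\mathcal V=\{V:\operatorname{Hom}(U,V)=0\ \forall U\in\mathcal U[1]\}$ and $\mathcal U[1]=\{U:\operatorname{Hom}(U,V)=0\ \forall V\in\mathcal V\}$; (ii) $\mathcal U[1]\subseteq\mathcal U$; (iii) each $M\in\underline{\mathcal C}$ lies in a triangle $A\to M\to B\to A[1]$ with $A\in\mathcal U[1]$, $B\in\mathcal V$. It is a Bousfield localizing pair if moreover $\mathcal U$ is a triangulated subcategory. Let $(\mathcal F,\mathcal T)$ be a cotorsion pair in $\mathcal C$ and put $(\mathcal X,\mathcal Y)=(\underline{\Omega\mathcal F},\underline{\mathcal T})$. Then the following are equivalent: 1. $(\mathcal F,\mathcal T)$ is complete and $\mathcal F\cap\mathcal T=\mathcal P$; 2. $(\mathcal F,\mathcal T)$ is complete and cohereditary; 3. for each $M\in\underline{\mathcal C}$ there is a triangle $X\to M\to Y\to X[1]$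 with $X\in\mathcal X$, $Y\in\mathcal Y$, and any two such triangles are isomorphic; 3'. as in 3, and any two such triangles are isomorphic by an isomorphism that is the identity on $M$; 4. $(\mathcal X[-1],\mathcal Y)$ is a t-structure in $\underline{\mathcal C}$. The assignment $(\mathcal F,\mathcal T)\mapsto(\mathcal X[-1],\mathcal Y)=(\underline{\Omega^2\mathcal F},\underline{\mathcal T})$ is a bijection from the complete cohereditary cotorsion pairs in $\mathcal C$ to the t-structures in $\underline{\mathcal C}$. It restricts to a bijection from the complete hereditary and cohereditary cotorsion pairs in $\mathcal C$ to the Bousfield localizing pairs in $\underline{\mathcal C}$, and for such cotorsion pairs $(\mathcal X[-1],\mathcal Y)=(\underline{\mathcal F},\underline{\mathcal T})$. -/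

import Mathlib

open CategoryTheory CategoryTheory.Limits
open scoped ZeroObject

universe v u

/-! ### Exact categories -/

/-- An exact structure (in the sense of Quillen) on an additive category `C`: a class of
conflations, closed under isomorphism and consisting of kernel-cokernel pairs, satisfying the
usual axioms.  (That `C` has a zero object and binary biproducts is assumed separately.) -/
structure ExactStructure (C : Type u) [Category.{v} C] [Preadditive C] where
  /-- The sequences `0 ⟶ X₁ ⟶ X₂ ⟶ X₃ ⟶ 0` which are conflations. -/
  conflation : ObjectProperty (ShortComplex C)
  /-- Conflations are closed under isomorphism. -/
  conflation_of_iso : ∀ {S T : ShortComplex C}, (S ≅ T) → conflation S → conflation T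
  /-- The first map of a conflation is a kernel of the second. -/
  isKernel : ∀ {S : ShortComplex C}, conflation S →
    Nonempty (IsLimit (KernelFork.ofι S.f S.zero))
  /-- The second map of a conflation is a cokernel of the first. -/
  isCokernel : ∀ {S : ShortComplex C}, conflation S →
    Nonempty (IsColimit (CokernelCofork.ofπ S.g S.zero))
  /-- Identities are inflations. -/
  id_inflation : ∀ X : C, ∃ (Z : C) (p : X ⟶ Z) (w : 𝟙 X ≫ p = 0),
    conflation (ShortComplex.mk (𝟙 X) p w)
  /-- Identities are deflations. -/
  id_deflation : ∀ X : C, ∃ (K : C) (i : K ⟶ X) (w : i ≫ 𝟙 X = 0),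
    conflation (ShortComplex.mk i (𝟙 X) w)
  /-- Inflations are closed under composition. -/
  comp_inflation : ∀ {X Y Z : C} (i : X ⟶ Y) (j : Y ⟶ Z),
    (∃ (A : C) (p : Y ⟶ A) (w : i ≫ p = 0), conflation (ShortComplex.mk i p w)) →
    (∃ (A : C) (p : Z ⟶ A) (w : j ≫ p = 0), conflation (ShortComplex.mk j p w)) →
    ∃ (A : C) (p : Z ⟶ A) (w : (i ≫ j) ≫ p = 0), conflation (ShortComplex.mk (i ≫ j) p w)
  /-- Deflations are closed under composition. -/
  comp_deflation : ∀ {X Y Z : C} (p : X ⟶ Y) (q : Y ⟶ Z),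
    (∃ (K : C) (i : K ⟶ X) (w : i ≫ p = 0), conflation (ShortComplex.mk i p w)) →
    (∃ (K : C) (i : K ⟶ Y) (w : i ≫ q = 0), conflation (ShortComplex.mk i q w)) →
    ∃ (K : C) (i : K ⟶ X) (w : i ≫ p ≫ q = 0), conflation (ShortComplex.mk i (p ≫ q) w)
  /-- The pushout of an inflation along an arbitrary map exists and is an inflation. -/
  pushout_inflation : ∀ {X Y X' : C} (i : X ⟶ Y) (f : X ⟶ X'),
    (∃ (A : C) (p : Y ⟶ A) (w : i ≫ p = 0), conflation (ShortComplex.mk i p w)) →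
    ∃ (Y' : C) (i' : X' ⟶ Y') (f' : Y ⟶ Y'), IsPushout i f f' i' ∧
      ∃ (A : C) (p : Y' ⟶ A) (w : i' ≫ p = 0), conflation (ShortComplex.mk i' p w)
  /-- The pullback of a deflation along an arbitrary map exists and is a deflation. -/
  pullback_deflation : ∀ {Y Z Z' : C} (p : Y ⟶ Z) (f : Z' ⟶ Z),
    (∃ (K : C) (i : K ⟶ Y) (w : i ≫ p = 0), conflation (ShortComplex.mk i p w)) →
    ∃ (Y' : C) (p' : Y' ⟶ Z') (f' : Y' ⟶ Y), IsPullback f' p' p f ∧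
      ∃ (K : C) (i : K ⟶ Y') (w : i ≫ p' = 0), conflation (ShortComplex.mk i p' w)

namespace ExactStructure

variable {C : Type u} [Category.{v} C] [Preadditive C] (E : ExactStructure C)

/-- `i` is an inflation: it is the first map of some conflation. -/
def Inflation {X Y : C} (i : X ⟶ Y) : Prop :=
  ∃ (Z : C) (p : Y ⟶ Z) (w : i ≫ p = 0), E.conflation (ShortComplex.mk i p w)

/-- `p` is a deflation: it is the second map of some conflation. -/
def Deflation {Y Z : C} (p : Y ⟶ Z) : Prop :=
  ∃ (X : C) (i : X ⟶ Y) (w : i ≫ p = 0), E.conflation (ShortComplex.mk i p w)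

/-- The injective objects: every inflation starting in `I` splits. -/
def injectives : ObjectProperty C :=
  fun I => ∀ ⦃Y : C⦄ (i : I ⟶ Y), E.Inflation i → IsSplitMono i

/-- The projective objects: every deflation ending in `P` splits. -/
def projectives : ObjectProperty C :=
  fun P => ∀ ⦃Y : C⦄ (p : Y ⟶ P), E.Deflation p → IsSplitEpi p

/-- Frobenius exact categories. -/
class IsFrobenius : Prop where
  enough_projectives : ∀ X : C, ∃ (P : C) (p : P ⟶ X), E.Deflation p ∧ E.projectives P
  enough_injectives : ∀ X : C, ∃ (I : C) (i : X ⟶ I), E.Inflation i ∧ E.injectives I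
  projectives_eq_injectives : E.projectives = E.injectives

/-! ### Yoneda `Ext¹` and cotorsion pairs -/

/-- A conflation `0 ⟶ B ⟶ mid ⟶ A ⟶ 0`. -/
structure Extension (A B : C) where
  mid : C
  i : B ⟶ mid
  p : mid ⟶ A
  w : i ≫ p = 0
  conf : E.conflation (ShortComplex.mk i p w)

/-- Equivalence of extensions: an isomorphism of the middle terms inducing the identities on
the outer terms. -/
instance extensionSetoid (A B : C) : Setoid (E.Extension A B) where
  r S T := ∃ e : S.mid ≅ T.mid, S.i ≫ e.hom = T.i ∧ e.hom ≫ T.p = S.p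
  iseqv :=
    { refl := fun S => ⟨Iso.refl _, by simp, by simp⟩
      symm := by
        rintro S T ⟨e, h₁, h₂⟩
        exact ⟨e.symm, by simp [← h₁], by simp [← h₂]⟩
      trans := by
        rintro S T U ⟨e, h₁, h₂⟩ ⟨e', h₁', h₂'⟩
        exact ⟨e ≪≫ e', by simp [← h₁', ← h₁], by simp [h₂', h₂]⟩ }

/-- The Yoneda `Ext¹(A, B)`: equivalence classes of conflations `0 ⟶ B ⟶ M ⟶ A ⟶ 0`.
The zero class is that of the split conflation, so `Ext¹(A, B) = 0` means that this type
has just one element. -/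
def Ext1 (A B : C) : Type (max u v) := _root_.Quotient (E.extensionSetoid A B)

/-- The class `𝒮^{⊥₁}` of all `Y` with `Ext¹(S, Y) = 0` for all `S ∈ 𝒮`. -/
def rightExtOrthogonal (S : ObjectProperty C) : ObjectProperty C :=
  fun Y => ∀ X : C, S X → Subsingleton (E.Ext1 X Y)

/-- The class `^{⊥₁}𝒮` of all `X` with `Ext¹(X, S) = 0` for all `S ∈ 𝒮`. -/
def leftExtOrthogonal (S : ObjectProperty C) : ObjectProperty C :=
  fun X => ∀ Y : C, S Y → Subsingleton (E.Ext1 X Y)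

/-- Cotorsion pairs. -/
structure IsCotorsionPair (F T : ObjectProperty C) : Prop where
  right_eq : E.rightExtOrthogonal F = T
  left_eq : F = E.leftExtOrthogonal T

/-- Complete cotorsion pairs: cotorsion pairs for which every object `M` has conflations
`0 ⟶ T ⟶ F ⟶ M ⟶ 0` and `0 ⟶ M ⟶ T' ⟶ F' ⟶ 0`. -/
structure IsCompleteCotorsionPair (F T : ObjectProperty C) : Prop
    extends E.IsCotorsionPair F T where
  exists_left : ∀ M : C, ∃ (Y X : C) (i : Y ⟶ X) (p : X ⟶ M) (w : i ≫ p = 0),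
    T Y ∧ F X ∧ E.conflation (ShortComplex.mk i p w)
  exists_right : ∀ M : C, ∃ (Y X : C) (i : M ⟶ Y) (p : Y ⟶ X) (w : i ≫ p = 0),
    T Y ∧ F X ∧ E.conflation (ShortComplex.mk i p w)

/-- `Ω 𝒮`: all syzygies of objects of `𝒮`, i.e. all kernels of deflations `P ⟶ X` with
`P` projective and `X ∈ 𝒮`. -/
def syzygies (S : ObjectProperty C) : ObjectProperty C :=
  fun Z => ∃ (X P : C) (i : Z ⟶ P) (p : P ⟶ X) (w : i ≫ p = 0),
    S X ∧ E.projectives P ∧ E.conflation (ShortComplex.mk i p w)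

/-- `Ω⁻¹ 𝒮`: all cosyzygies of objects of `𝒮`, i.e. all cokernels of inflations `X ⟶ I` with
`I` injective and `X ∈ 𝒮`. -/
def cosyzygies (S : ObjectProperty C) : ObjectProperty C :=
  fun Z => ∃ (X I : C) (i : X ⟶ I) (p : I ⟶ Z) (w : i ≫ p = 0),
    S X ∧ E.injectives I ∧ E.conflation (ShortComplex.mk i p w)

/-- The condition `Ω ℱ ⊆ ℱ` (for a cotorsion pair `(ℱ, 𝒯)`: being hereditary). -/
def Hereditary (F : ObjectProperty C) : Prop := E.syzygies F ≤ F

/-- The condition `Ω⁻¹ ℱ ⊆ ℱ` (for a cotorsion pair `(ℱ, 𝒯)`: being cohereditary). -/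
def Cohereditary (F : ObjectProperty C) : Prop := E.cosyzygies F ≤ F

/-! ### The stable category -/

/-- A morphism factors through a projective object. -/
def FactorsThruProj {X Y : C} (f : X ⟶ Y) : Prop :=
  ∃ (P : C) (a : X ⟶ P) (b : P ⟶ Y), E.projectives P ∧ a ≫ b = f

/-- Two morphisms are identified in the stable category when their difference factors through
a projective object. -/
def stableRel : HomRel C := fun _ _ f g => E.FactorsThruProj (f - g)

lemma proj_lift {P Y Z : C} (hP : E.projectives P) (p : Y ⟶ Z) (hp : E.Deflation p)
    (f : P ⟶ Z) : ∃ g : P ⟶ Y, g ≫ p = f := by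
  obtain ⟨Y', p', f', sq, h⟩ := E.pullback_deflation p f hp
  obtain ⟨⟨s⟩⟩ := hP p' h
  exact ⟨s.section_ ≫ f', by rw [Category.assoc, sq.w, SplitEpi.id_assoc]⟩

lemma inj_extend {I X Y : C} (hI : E.injectives I) (i : X ⟶ Y) (hi : E.Inflation i)
    (f : X ⟶ I) : ∃ g : Y ⟶ I, i ≫ g = f := by
  obtain ⟨Y', i', f', sq, h⟩ := E.pushout_inflation i f hi
  obtain ⟨⟨s⟩⟩ := hI i' h
  exact ⟨f' ≫ s.retraction, by rw [← Category.assoc, sq.w, Category.assoc, s.id, Category.comp_id]⟩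

lemma factors_neg {X Y : C} {f : X ⟶ Y} (hf : E.FactorsThruProj f) :
    E.FactorsThruProj (-f) := by
  obtain ⟨P, a, b, hP, rfl⟩ := hf
  exact ⟨P, a, -b, hP, by simp⟩

section Stable

set_option linter.unusedSectionVars false

variable [HasZeroObject C] [HasBinaryBiproducts C]

lemma projectives_biprod {P Q : C} (hP : E.projectives P) (hQ : E.projectives Q) :
    E.projectives (P ⊞ Q) := by
  intro Y p hp
  obtain ⟨a, ha⟩ := E.proj_lift hP p hp biprod.inl
  obtain ⟨b, hb⟩ := E.proj_lift hQ p hp biprod.inr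
  exact ⟨⟨⟨biprod.desc a b, by ext <;> simp [ha, hb]⟩⟩⟩

lemma projectives_zero : E.projectives (0 : C) :=
  fun _ _ _ => ⟨⟨⟨0, (isZero_zero C).eq_of_src _ _⟩⟩⟩

lemma factors_zero (X Y : C) : E.FactorsThruProj (0 : X ⟶ Y) :=
  ⟨0, 0, 0, E.projectives_zero, by simp⟩

lemma factors_add {X Y : C} {f g : X ⟶ Y} (hf : E.FactorsThruProj f)
    (hg : E.FactorsThruProj g) : E.FactorsThruProj (f + g) := by
  obtain ⟨P, a, b, hP, rfl⟩ := hf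
  obtain ⟨Q, c, d, hQ, rfl⟩ := hg
  exact ⟨P ⊞ Q, biprod.lift a c, biprod.desc b d, E.projectives_biprod hP hQ, by simp⟩

instance stableRel_congruence : Congruence E.stableRel where
  equivalence :=
    { refl := fun f => by
        change E.FactorsThruProj (f - f)
        rw [sub_self]
        exact E.factors_zero _ _
      symm := fun {f g} h => by
        change E.FactorsThruProj (g - f)
        rw [← neg_sub]
        exact E.factors_neg h
      trans := fun {f g k} h₁ h₂ => by
        change E.FactorsThruProj (f - k)
        rw [← sub_add_sub_cancel f g k]
        exact E.factors_add h₁ h₂ }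
  comp_left := by
    rintro X Y Z f g g' ⟨P, a, b, hP, h⟩
    exact ⟨P, f ≫ a, b, hP, by rw [Category.assoc, h, Preadditive.comp_sub]⟩
  comp_right := by
    rintro X Y Z f f' g ⟨P, a, b, hP, h⟩
    exact ⟨P, a, b ≫ g, hP, by rw [← Category.assoc, h, Preadditive.sub_comp]⟩

lemma stableRel_refl {X Y : C} (f : X ⟶ Y) : E.stableRel f f :=
  Congruence.equivalence.refl f

/-- The stable category: the objects of `C`, and morphisms of `C` modulo those which factor
through a projective object. -/
abbrev Stable := CategoryTheory.Quotient E.stableRel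

/-- The projection functor from `C` to the stable category. -/
abbrev proj : C ⥤ E.Stable := CategoryTheory.Quotient.functor E.stableRel

instance stablePreadditive : Preadditive E.Stable :=
  CategoryTheory.Quotient.preadditive E.stableRel (fun _ _ f₁ f₂ g₁ g₂ h₁ h₂ => by
    change E.FactorsThruProj (f₁ + g₁ - (f₂ + g₂))
    rw [add_sub_add_comm]
    exact E.factors_add h₁ h₂)

/-- `\underline{𝒮}`: the essential image of `𝒮` in the stable category. -/
def stableImage (S : ObjectProperty C) : ObjectProperty E.Stable := S.map E.proj

/-- Hom-orthogonal pairs: `𝒳^⊥ = 𝒴` and `𝒳 = ^⊥𝒴`. -/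
structure IsHomOrthogonalPair (X Y : ObjectProperty E.Stable) : Prop where
  right_eq : X.rightOrthogonal = Y
  left_eq : X = Y.leftOrthogonal

/-! ### The suspension of the stable category -/

variable [E.IsFrobenius]

lemma exists_cosyzygy (X : C) : ∃ (I Z : C) (i : X ⟶ I) (p : I ⟶ Z) (w : i ≫ p = 0),
    E.injectives I ∧ E.conflation (ShortComplex.mk i p w) := by
  obtain ⟨I, i, ⟨Z, p, w, h⟩, hI⟩ := IsFrobenius.enough_injectives (E := E) X
  exact ⟨I, Z, i, p, w, hI, h⟩

/-- A chosen injective object `I(X)` containing `X`. -/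
noncomputable def hull (X : C) : C := (E.exists_cosyzygy X).choose

/-- The chosen cosyzygy `Ω⁻¹X`. -/
noncomputable def cosyzygy (X : C) : C := (E.exists_cosyzygy X).choose_spec.choose

/-- The inflation of the chosen conflation `0 ⟶ X ⟶ I(X) ⟶ Ω⁻¹X ⟶ 0`. -/
noncomputable def hullι (X : C) : X ⟶ E.hull X :=
  (E.exists_cosyzygy X).choose_spec.choose_spec.choose

/-- The deflation of the chosen conflation `0 ⟶ X ⟶ I(X) ⟶ Ω⁻¹X ⟶ 0`. -/
noncomputable def hullπ (X : C) : E.hull X ⟶ E.cosyzygy X :=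
  (E.exists_cosyzygy X).choose_spec.choose_spec.choose_spec.choose

lemma hull_w (X : C) : E.hullι X ≫ E.hullπ X = 0 :=
  (E.exists_cosyzygy X).choose_spec.choose_spec.choose_spec.choose_spec.choose

lemma hull_injective (X : C) : E.injectives (E.hull X) :=
  (E.exists_cosyzygy X).choose_spec.choose_spec.choose_spec.choose_spec.choose_spec.1

lemma hull_conflation (X : C) :
    E.conflation (ShortComplex.mk (E.hullι X) (E.hullπ X) (E.hull_w X)) :=
  (E.exists_cosyzygy X).choose_spec.choose_spec.choose_spec.choose_spec.choose_spec.2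

lemma hull_desc {X Z : C} (k : E.hull X ⟶ Z) (hk : E.hullι X ≫ k = 0) :
    ∃ l : E.cosyzygy X ⟶ Z, E.hullπ X ≫ l = k := by
  obtain ⟨hc⟩ := E.isCokernel (E.hull_conflation X)
  exact ⟨hc.desc (CokernelCofork.ofπ k hk), hc.fac _ WalkingParallelPair.one⟩

lemma hull_epi {X Z : C} {k l : E.cosyzygy X ⟶ Z} (h : E.hullπ X ≫ k = E.hullπ X ≫ l) :
    k = l := by
  obtain ⟨hc⟩ := E.isCokernel (E.hull_conflation X)
  exact Cofork.IsColimit.hom_ext hc h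

/-- `h : Ω⁻¹X ⟶ Ω⁻¹Y` is induced by `f : X ⟶ Y`, through a map `g : I(X) ⟶ I(Y)`. -/
def IsSuspHom {X Y : C} (f : X ⟶ Y) (h : E.cosyzygy X ⟶ E.cosyzygy Y) : Prop :=
  ∃ g : E.hull X ⟶ E.hull Y, E.hullι X ≫ g = f ≫ E.hullι Y ∧ g ≫ E.hullπ Y = E.hullπ X ≫ h

lemma exists_suspHom {X Y : C} (f : X ⟶ Y) : ∃ h, E.IsSuspHom f h := by
  obtain ⟨g, hg⟩ := E.inj_extend (E.hull_injective Y) (E.hullι X)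
    ⟨_, _, _, E.hull_conflation X⟩ (f ≫ E.hullι Y)
  obtain ⟨h, hh⟩ := E.hull_desc (g ≫ E.hullπ Y)
    (by rw [← Category.assoc, hg, Category.assoc, E.hull_w, comp_zero])
  exact ⟨h, g, hg, hh.symm⟩

/-- The map induced on cosyzygies is determined in the stable category by the stable class of
the given map. -/
lemma isSuspHom_unique {X Y : C} {f f' : X ⟶ Y} {h h' : E.cosyzygy X ⟶ E.cosyzygy Y}
    (hf : E.IsSuspHom f h) (hf' : E.IsSuspHom f' h') (hff' : E.stableRel f f') :
    E.stableRel h h' := by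
  obtain ⟨g, h₁, h₂⟩ := hf
  obtain ⟨g', h₁', h₂'⟩ := hf'
  obtain ⟨P, a, b, hP, hab⟩ := hff'
  have hP' : E.injectives P := by
    rw [← IsFrobenius.projectives_eq_injectives (E := E)]; exact hP
  obtain ⟨a', ha'⟩ := E.inj_extend hP' (E.hullι X) ⟨_, _, _, E.hull_conflation X⟩ a
  obtain ⟨t, ht⟩ := E.hull_desc (g - g' - a' ≫ b ≫ E.hullι Y) (by
    rw [Preadditive.comp_sub, Preadditive.comp_sub, h₁, h₁', ← Category.assoc (E.hullι X) a',
      ha', ← Category.assoc a, hab, Preadditive.sub_comp, sub_self])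
  refine ⟨E.hull Y, t, E.hullπ Y, ?_, ?_⟩
  · rw [IsFrobenius.projectives_eq_injectives (E := E)]
    exact E.hull_injective Y
  · apply E.hull_epi
    rw [← Category.assoc, ht, Preadditive.sub_comp, Preadditive.sub_comp, h₂, h₂',
      Category.assoc, Category.assoc, E.hull_w, comp_zero, comp_zero, sub_zero,
      Preadditive.comp_sub]

/-- A map `Ω⁻¹X ⟶ Ω⁻¹Y` induced by `f : X ⟶ Y`. -/
noncomputable def suspHom {X Y : C} (f : X ⟶ Y) : E.cosyzygy X ⟶ E.cosyzygy Y :=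
  (E.exists_suspHom f).choose

lemma suspHom_spec {X Y : C} (f : X ⟶ Y) : E.IsSuspHom f (E.suspHom f) :=
  (E.exists_suspHom f).choose_spec

/-- The cosyzygy construction as a functor from `C` to the stable category. -/
noncomputable def preSusp : C ⥤ E.Stable where
  obj X := E.proj.obj (E.cosyzygy X)
  map f := E.proj.map (E.suspHom f)
  map_id X := by
    rw [← E.proj.map_id]
    exact CategoryTheory.Quotient.sound _ (E.isSuspHom_unique (E.suspHom_spec (𝟙 X))
      ⟨𝟙 _, by simp, by simp⟩ (E.stableRel_refl _))
  map_comp {X Y Z} f g := by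
    rw [← E.proj.map_comp]
    obtain ⟨a, ha₁, ha₂⟩ := E.suspHom_spec f
    obtain ⟨b, hb₁, hb₂⟩ := E.suspHom_spec g
    refine CategoryTheory.Quotient.sound _ (E.isSuspHom_unique (E.suspHom_spec (f ≫ g))
      ⟨a ≫ b, ?_, ?_⟩ (E.stableRel_refl _))
    · rw [← Category.assoc, ha₁, Category.assoc, hb₁, Category.assoc]
    · rw [Category.assoc, hb₂, ← Category.assoc, ha₂, Category.assoc]

/-- The suspension functor `[1] = Ω⁻¹` of the stable category. -/
noncomputable def susp : E.Stable ⥤ E.Stable :=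
  CategoryTheory.Quotient.lift E.stableRel E.preSusp (fun _ _ f f' h =>
    CategoryTheory.Quotient.sound _ (E.isSuspHom_unique (E.suspHom_spec f) (E.suspHom_spec f') h))

/-! ### The triangles of the stable category -/

/-- A sextuple `X ⟶ M ⟶ Y ⟶ X[1]` in the stable category. -/
structure StableTriangle where
  obj₁ : E.Stable
  obj₂ : E.Stable
  obj₃ : E.Stable
  mor₁ : obj₁ ⟶ obj₂
  mor₂ : obj₂ ⟶ obj₃
  mor₃ : obj₃ ⟶ E.susp.obj obj₁

variable {E} in
/-- Isomorphisms of sextuples. -/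
structure StableTriangle.Iso (S T : E.StableTriangle) where
  iso₁ : S.obj₁ ≅ T.obj₁
  iso₂ : S.obj₂ ≅ T.obj₂
  iso₃ : S.obj₃ ≅ T.obj₃
  comm₁ : S.mor₁ ≫ iso₂.hom = iso₁.hom ≫ T.mor₁
  comm₂ : S.mor₂ ≫ iso₃.hom = iso₂.hom ≫ T.mor₂
  comm₃ : S.mor₃ ≫ E.susp.map iso₁.hom = iso₃.hom ≫ T.mor₃

/-- The standard triangles `X ⟶ Y ⟶ W ⟶ X[1]`: for `f : X ⟶ Y` one forms the morphism of
conflations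
```
0 ⟶ X ⟶ I(X) ⟶ Ω⁻¹X ⟶ 0
    |f   |j      ‖
0 ⟶ Y ⟶  W   ⟶ Ω⁻¹X ⟶ 0
      v      w
```
whose left hand square is a pushout, and takes the images of `f`, `v`, `w` in the stable
category. -/
inductive IsStandard : E.StableTriangle → Prop
  | mk {X Y W : C} (f : X ⟶ Y) (v : Y ⟶ W) (j : E.hull X ⟶ W) (w : W ⟶ E.cosyzygy X)
      (sq : IsPushout f (E.hullι X) v j) (hv : v ≫ w = 0) (hj : j ≫ w = E.hullπ X) :
      IsStandard
        { obj₁ := E.proj.obj X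
          obj₂ := E.proj.obj Y
          obj₃ := E.proj.obj W
          mor₁ := E.proj.map f
          mor₂ := E.proj.map v
          mor₃ := E.proj.map w }

/-- The (distinguished) triangles of the stable category: the sextuples isomorphic to a
standard triangle. -/
def IsTriangle (T : E.StableTriangle) : Prop :=
  ∃ S : E.StableTriangle, E.IsStandard S ∧ Nonempty (StableTriangle.Iso S T)

/-! ### Approximation triangles, t-structures, Bousfield localizing pairs -/

/-- `𝒳[1]`, the essential image of `𝒳` under the suspension. -/
def shiftUp (X : ObjectProperty E.Stable) : ObjectProperty E.Stable := X.map E.susp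

/-- `𝒳[-1]`: the objects `Z` such that `Z[1]` is isomorphic to an object of `𝒳`. -/
def shiftDown (X : ObjectProperty E.Stable) : ObjectProperty E.Stable :=
  X.isoClosure.inverseImage E.susp

/-- `A ⟶ M ⟶ B ⟶ A[1]` is a triangle with `A ∈ 𝒳` and `B ∈ 𝒴`. -/
def IsApproximation (X Y : ObjectProperty E.Stable) {A M B : E.Stable}
    (f : A ⟶ M) (g : M ⟶ B) (h : B ⟶ E.susp.obj A) : Prop :=
  X A ∧ Y B ∧ E.IsTriangle ⟨A, M, B, f, g, h⟩

/-- Every object `M` lies in a triangle `A ⟶ M ⟶ B ⟶ A[1]` with `A ∈ 𝒳` and `B ∈ 𝒴`. -/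
def HasApproximations (X Y : ObjectProperty E.Stable) : Prop :=
  ∀ M : E.Stable, ∃ (A B : E.Stable) (f : A ⟶ M) (g : M ⟶ B) (h : B ⟶ E.susp.obj A),
    E.IsApproximation X Y f g h

/-- For every object `M`, any two triangles `A ⟶ M ⟶ B ⟶ A[1]` with `A ∈ 𝒳` and `B ∈ 𝒴` are
isomorphic. -/
def ApproximationsUnique (X Y : ObjectProperty E.Stable) : Prop :=
  ∀ ⦃M A B A' B' : E.Stable⦄ (f : A ⟶ M) (g : M ⟶ B) (h : B ⟶ E.susp.obj A)
    (f' : A' ⟶ M) (g' : M ⟶ B') (h' : B' ⟶ E.susp.obj A'),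
    E.IsApproximation X Y f g h → E.IsApproximation X Y f' g' h' →
    Nonempty (StableTriangle.Iso (E := E) ⟨A, M, B, f, g, h⟩ ⟨A', M, B', f', g', h'⟩)

/-- For every object `M`, any two triangles `A ⟶ M ⟶ B ⟶ A[1]` with `A ∈ 𝒳` and `B ∈ 𝒴` are
isomorphic by an isomorphism which is the identity on `M`. -/
def ApproximationsUniqueOver (X Y : ObjectProperty E.Stable) : Prop :=
  ∀ ⦃M A B A' B' : E.Stable⦄ (f : A ⟶ M) (g : M ⟶ B) (h : B ⟶ E.susp.obj A)
    (f' : A' ⟶ M) (g' : M ⟶ B') (h' : B' ⟶ E.susp.obj A'),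
    E.IsApproximation X Y f g h → E.IsApproximation X Y f' g' h' →
    ∃ e : StableTriangle.Iso (E := E) ⟨A, M, B, f, g, h⟩ ⟨A', M, B', f', g', h'⟩,
      e.iso₂ = CategoryTheory.Iso.refl M

/-- t-structures.  Full subcategories are understood to be closed under isomorphism, which has
to be said only for `𝒳`, since the first condition implies it for `𝒴`. -/
structure IsTStructure (X Y : ObjectProperty E.Stable) : Prop where
  closed : X.IsClosedUnderIsomorphisms
  orthogonal : E.IsHomOrthogonalPair (E.shiftUp X) Y
  shift_le : E.shiftUp X ≤ X
  exists_triangle : E.HasApproximations (E.shiftUp X) Y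

/-- (Strictly full) triangulated subcategories of the stable category. -/
structure IsTriangulatedSubcategory (X : ObjectProperty E.Stable) : Prop where
  closed : X.IsClosedUnderIsomorphisms
  zero : X.ContainsZero
  shift_eq : X = E.shiftUp X
  cone : ∀ T : E.StableTriangle, E.IsTriangle T → X T.obj₁ → X T.obj₂ → X T.obj₃

/-- Bousfield localizing pairs: t-structures `(𝒳, 𝒴)` such that `𝒳` is a triangulated
subcategory. -/
structure IsBousfieldLocalizingPair (X Y : ObjectProperty E.Stable) : Prop
    extends E.IsTStructure X Y where
  triangulated : E.IsTriangulatedSubcategory X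

end Stable

end ExactStructure

/-! In a Frobenius category `Ext¹(A, B)` vanishes exactly when `Hom(ΩA, B)` vanishes in the stable
category. Hence both classes of a cotorsion pair are closed under stable isomorphism and can be
recovered from their stable images, and the two orthogonality conditions say that `𝒳 = ΩF` and `𝒴 =
T` are Hom-orthogonal in the stable category. Conversely every Hom-orthogonal pair arises in this
way (`IsHomOrthogonalPair.exists_isCotorsionPair`).

The other conditions translate as well. Completeness is the existence of approximation triangles: a
conflation `M ⟶ Y ⟶ X` gives a triangle `ΩX ⟶ M ⟶ Y`, and conversely such a triangle over `ΩM` gives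
by pushout a conflation ending in `M` (`exists_left_of_hasApproximations`), after which Salce's
trick gives the other conflation. Cohereditary means `𝒳[1] ⊆ 𝒳`, hereditary means `𝒳[-1] ⊆ 𝒳`. So
complete cohereditary pairs are t-structures (`isTStructure_iff`), and being hereditary too amounts
to `𝒳[1] = 𝒳`, the Bousfield case.

For the uniqueness conditions: if `𝒳[1] ⊆ 𝒳`, orthogonality makes approximation triangles unique
over `M`. Uniqueness applied to `M = 0` forces the objects of `F ⊓ T` to be projective. If they are,
a pullback argument shows that cosyzygies of `F` stay in `F` (`cohereditary_of_inf_eq`).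

Of the triangulated structure only extension of squares to morphisms and a few exactness statements
for `Hom` are needed; they are checked directly on standard triangles. -/

namespace ExactStructure

variable {C : Type u} [Category.{v} C] [Preadditive C] {E : ExactStructure C}

/-! ### Conflations -/

variable (E) in
/-- The composable maps `i` and `p` form a conflation. -/
def IsConflation {X Y Z : C} (i : X ⟶ Y) (p : Y ⟶ Z) : Prop :=
  ∃ w : i ≫ p = 0, E.conflation (ShortComplex.mk i p w)

namespace IsConflation

variable {X Y Z : C} {i : X ⟶ Y} {p : Y ⟶ Z}

lemma w (h : E.IsConflation i p) : i ≫ p = 0 := h.choose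

lemma inflation (h : E.IsConflation i p) : E.Inflation i := ⟨_, p, h⟩

lemma deflation (h : E.IsConflation i p) : E.Deflation p := ⟨_, i, h⟩

lemma exists_desc (h : E.IsConflation i p) {T : C} (k : Y ⟶ T) (hk : i ≫ k = 0) :
    ∃ l : Z ⟶ T, p ≫ l = k := by
  obtain ⟨hc⟩ := E.isCokernel h.choose_spec
  exact ⟨hc.desc (CokernelCofork.ofπ k hk), hc.fac _ WalkingParallelPair.one⟩

lemma exists_lift (h : E.IsConflation i p) {T : C} (k : T ⟶ Y) (hk : k ≫ p = 0) :
    ∃ l : T ⟶ X, l ≫ i = k := by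
  obtain ⟨hc⟩ := E.isKernel h.choose_spec
  exact ⟨hc.lift (KernelFork.ofι k hk), hc.fac _ WalkingParallelPair.zero⟩

lemma epi (h : E.IsConflation i p) : Epi p := by
  obtain ⟨hc⟩ := E.isCokernel h.choose_spec
  exact ⟨fun _ _ e => Cofork.IsColimit.hom_ext hc e⟩

lemma mono (h : E.IsConflation i p) : Mono i := by
  obtain ⟨hc⟩ := E.isKernel h.choose_spec
  exact ⟨fun _ _ e => Fork.IsLimit.hom_ext hc e⟩

lemma of_iso (h : E.IsConflation i p) {X' Y' Z' : C} {i' : X' ⟶ Y'} {p' : Y' ⟶ Z'}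
    (a : X ≅ X') (b : Y ≅ Y') (c : Z ≅ Z') (h₁ : i ≫ b.hom = a.hom ≫ i')
    (h₂ : p ≫ c.hom = b.hom ≫ p') : E.IsConflation i' p' := by
  have w' : i' ≫ p' = 0 := by
    rw [← cancel_epi a.hom, ← Category.assoc, ← h₁, Category.assoc, ← h₂, ← Category.assoc, h.w,
      zero_comp, comp_zero]
  exact ⟨w', E.conflation_of_iso (ShortComplex.isoMk a b c h₁.symm h₂.symm) h.choose_spec⟩

/-- A kernel of a deflation, with the deflation, is a conflation. -/
lemma of_kernel (hp : E.Deflation p) (w : i ≫ p = 0) [Mono i]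
    (hi : ∀ {T : C} (k : T ⟶ Y), k ≫ p = 0 → ∃ l : T ⟶ X, l ≫ i = k) : E.IsConflation i p := by
  obtain ⟨K, j, hj⟩ := hp
  have hj : E.IsConflation j p := hj
  have := hj.mono
  obtain ⟨a, ha⟩ := hi j hj.w
  obtain ⟨b, hb⟩ := hj.exists_lift i w
  refine hj.of_iso ⟨a, b, ?_, ?_⟩ (Iso.refl _) (Iso.refl _) (by simp [ha]) (by simp)
  · simp [← cancel_mono j, ha, hb]
  · simp [← cancel_mono i, ha, hb]

/-- A cokernel of an inflation, with the inflation, is a conflation. -/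
lemma of_cokernel (hi : E.Inflation i) (w : i ≫ p = 0) [Epi p]
    (hp : ∀ {T : C} (k : Y ⟶ T), i ≫ k = 0 → ∃ l : Z ⟶ T, p ≫ l = k) : E.IsConflation i p := by
  obtain ⟨K, q, hq⟩ := hi
  have hq : E.IsConflation i q := hq
  have := hq.epi
  obtain ⟨a, ha⟩ := hp q hq.w
  obtain ⟨b, hb⟩ := hq.exists_desc p w
  refine hq.of_iso (Iso.refl _) (Iso.refl _) ⟨b, a, ?_, ?_⟩ (by simp) (by simp [hb])
  · simp [← cancel_epi q, reassoc_of% hb, ha]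
  · simp [← cancel_epi p, reassoc_of% ha, hb]

lemma of_isPushout (h : E.IsConflation i p) {X' Y' : C} {f : X ⟶ X'} {f' : Y ⟶ Y'}
    {i' : X' ⟶ Y'} (sq : IsPushout i f f' i') {p' : Y' ⟶ Z} (hf : f' ≫ p' = p)
    (hi : i' ≫ p' = 0) : E.IsConflation i' p' := by
  have := h.epi
  have : Epi p' := epi_of_epi_fac hf
  obtain ⟨Y'', i'', f'', sq', A, q, hq⟩ := E.pushout_inflation i f h.inflation
  have hi' : E.Inflation i' := by
    refine ⟨A, (sq.isoIsPushout _ _ sq').hom ≫ q, IsConflation.of_iso (i := i'') (p := q) hq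
      (Iso.refl _) (sq.isoIsPushout _ _ sq').symm (Iso.refl _) ?_ ?_⟩
    · simp
    · simp
  refine of_cokernel hi' hi fun k hk => ?_
  obtain ⟨l, hl⟩ := h.exists_desc (f' ≫ k) (by
    rw [← Category.assoc, sq.w, Category.assoc, hk, comp_zero])
  exact ⟨l, sq.hom_ext (by rw [← hl, ← hf, Category.assoc])
    (by rw [← Category.assoc, hi, hk, zero_comp])⟩

lemma exists_pushout (h : E.IsConflation i p) {X' : C} (f : X ⟶ X') :
    ∃ (Y' : C) (i' : X' ⟶ Y') (f' : Y ⟶ Y') (p' : Y' ⟶ Z), IsPushout i f f' i' ∧ f' ≫ p' = p ∧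
      E.IsConflation i' p' := by
  obtain ⟨Y', i', f', sq, -⟩ := E.pushout_inflation i f h.inflation
  have w : i ≫ p = f ≫ 0 := by rw [h.w, comp_zero]
  exact ⟨Y', i', f', sq.desc p 0 w, sq, sq.inl_desc _ _ _,
    h.of_isPushout sq (sq.inl_desc _ _ _) (sq.inr_desc _ _ _)⟩

lemma of_isPullback (h : E.IsConflation i p) {Y' Z' : C} {f : Z' ⟶ Z} {f' : Y' ⟶ Y}
    {p' : Y' ⟶ Z'} (sq : IsPullback f' p' p f) {i' : X ⟶ Y'} (hf : i' ≫ f' = i)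
    (hi : i' ≫ p' = 0) : E.IsConflation i' p' := by
  have := h.mono
  have : Mono i' := mono_of_mono_fac hf
  obtain ⟨Y'', p'', f'', sq', A, q, hq⟩ := E.pullback_deflation p f h.deflation
  have hp' : E.Deflation p' := by
    refine ⟨A, q ≫ (sq.isoIsPullback _ _ sq').inv, IsConflation.of_iso (i := q) (p := p'') hq
      (Iso.refl _) (sq.isoIsPullback _ _ sq').symm (Iso.refl _) ?_ ?_⟩
    · simp
    · simp
  refine of_kernel hp' hi fun k hk => ?_
  obtain ⟨l, hl⟩ := h.exists_lift (k ≫ f') (by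
    rw [Category.assoc, sq.w, ← Category.assoc, hk, zero_comp])
  exact ⟨l, sq.hom_ext (by rw [← hl, ← hf, Category.assoc])
    (by rw [Category.assoc, hi, hk, comp_zero])⟩

lemma exists_pullback (h : E.IsConflation i p) {Z' : C} (f : Z' ⟶ Z) :
    ∃ (Y' : C) (i' : X ⟶ Y') (f' : Y' ⟶ Y) (p' : Y' ⟶ Z'), IsPullback f' p' p f ∧ i' ≫ f' = i ∧
      E.IsConflation i' p' := by
  obtain ⟨Y', p', f', sq, -⟩ := E.pullback_deflation p f h.deflation
  have w : i ≫ p = 0 ≫ f := by rw [h.w, zero_comp]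
  exact ⟨Y', sq.lift i 0 w, f', p', sq, sq.lift_fst _ _ _,
    h.of_isPullback sq (sq.lift_fst _ _ _) (sq.lift_snd _ _ _)⟩

lemma exists_section (h : E.IsConflation i p) {r : Y ⟶ X} (hr : i ≫ r = 𝟙 X) :
    ∃ s : Z ⟶ Y, s ≫ p = 𝟙 Z ∧ s ≫ r = 0 ∧ r ≫ i + p ≫ s = 𝟙 Y := by
  obtain ⟨s, hs⟩ := h.exists_desc (𝟙 Y - r ≫ i) (by simp [reassoc_of% hr])
  have := h.epi
  refine ⟨s, ?_, ?_, by simp [hs]⟩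
  · simp [← cancel_epi p, reassoc_of% hs, h.w]
  · simp [← cancel_epi p, reassoc_of% hs, hr]

lemma exists_retraction (h : E.IsConflation i p) {s : Z ⟶ Y} (hs : s ≫ p = 𝟙 Z) :
    ∃ r : Y ⟶ X, i ≫ r = 𝟙 X := by
  obtain ⟨r, hr⟩ := h.exists_lift (𝟙 Y - p ≫ s) (by simp [hs])
  have := h.mono
  exact ⟨r, by simp [← cancel_mono i, hr, reassoc_of% h.w]⟩

lemma exists_retraction_of_projective (h : E.IsConflation i p) (hZ : E.projectives Z) :
    ∃ r : Y ⟶ X, i ≫ r = 𝟙 X := by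
  obtain ⟨⟨s⟩⟩ := hZ p h.deflation
  exact h.exists_retraction s.id

/-- A morphism of conflations which is the identity on the outer terms is an isomorphism. -/
lemma isIso (h : E.IsConflation i p) {Y' : C} {i' : X ⟶ Y'} {p' : Y' ⟶ Z}
    (h' : E.IsConflation i' p') (d : Y ⟶ Y') (hi : i ≫ d = i') (hp : d ≫ p' = p) : IsIso d := by
  have := h'.mono
  -- Both projections of `V = Y' ×_Z Y` are deflations with kernel `X`. The graph `σ` of `d` splits
  -- `g₁`, and the retraction `r` of `e₁` that it defines is, up to sign, also a retraction of `e₂`.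
  -- Hence `g₂` has a section `τ` killed by `r`, and `τ ≫ g₁` is the inverse of `d`.
  obtain ⟨V, e₁, g₂, g₁, sq, he₁₂, he₁⟩ := h'.exists_pullback p
  have he₂ : E.IsConflation (sq.lift 0 i (by simp [h.w])) g₂ :=
    h.of_isPullback sq.flip (by simp) (by simp)
  have he₂₁ : sq.lift 0 i (by simp [h.w]) ≫ g₁ = i := by simp
  set e₂ := sq.lift 0 i (by simp [h.w])
  have hσ₁ : sq.lift d (𝟙 Y) (by simp [hp]) ≫ g₁ = 𝟙 Y := by simp
  have hσ₂ : sq.lift d (𝟙 Y) (by simp [hp]) ≫ g₂ = d := by simp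
  set σ := sq.lift d (𝟙 Y) (by simp [hp])
  obtain ⟨r, hr⟩ := he₁.exists_lift (𝟙 V - g₁ ≫ σ) (by simp [hσ₁])
  have := he₁.mono
  have hσr : σ ≫ r = 0 := by simp [← cancel_mono e₁, hr, reassoc_of% hσ₁]
  have he₂r : e₂ ≫ (-r) = 𝟙 X := by
    have : e₂ ≫ r ≫ e₁ ≫ g₂ = - i' := by
      simp [reassoc_of% hr, he₂.w, reassoc_of% he₂₁, hσ₂, hi]
    rw [he₁₂] at this
    simp [← cancel_mono i', this]
  obtain ⟨τ, hτ₂, hτr, hτ⟩ := he₂.exists_section he₂r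
  have hτr : τ ≫ r = 0 := by simpa using hτr
  refine ⟨τ ≫ g₁, ?_, ?_⟩
  · have := congr(σ ≫ $hτ ≫ g₁)
    simpa [reassoc_of% hσr, reassoc_of% hσ₂, hσ₁] using this
  · have := congr(τ ≫ $hr ≫ g₂)
    simp [reassoc_of% hτr, hτ₂, hσ₂] at this
    simp [sub_eq_zero.mp this.symm]

/-- A morphism of conflations which is the identity on the cokernels has a pushout as its left
hand square. -/
lemma isPushout (h : E.IsConflation i p) {X' Y' : C} {i' : X' ⟶ Y'} {p' : Y' ⟶ Z}
    (h' : E.IsConflation i' p') {f : X ⟶ X'} {f' : Y ⟶ Y'} (w : i ≫ f' = f ≫ i')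
    (hf : f' ≫ p' = p) : IsPushout i f f' i' := by
  obtain ⟨W, j, g, q, sq, hg, hj⟩ := h.exists_pushout f
  have hd := sq.inl_desc f' i' w
  have hd' := sq.inr_desc f' i' w
  set d := sq.desc f' i' w
  have := hj.isIso h' d hd' (sq.hom_ext (by rw [reassoc_of% hd, hf, hg])
    (by rw [reassoc_of% hd', h'.w, hj.w]))
  exact sq.of_iso (Iso.refl _) (Iso.refl _) (Iso.refl _) (asIso d) (by simp) (by simp)
    (by simp [hd]) (by simp [hd'])

/-- A morphism of conflations which is the identity on the kernels has a pullback as its right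
hand square. -/
lemma isPullback (h : E.IsConflation i p) {Y' Z' : C} {i' : X ⟶ Y'} {p' : Y' ⟶ Z'}
    (h' : E.IsConflation i' p') {f : Z ⟶ Z'} {f' : Y ⟶ Y'} (hf : i ≫ f' = i')
    (w : f' ≫ p' = p ≫ f) : IsPullback f' p p' f := by
  obtain ⟨W, j, g, q, sq, hg, hj⟩ := h'.exists_pullback f
  have hd := sq.lift_fst f' p w
  have hd' := sq.lift_snd f' p w
  set d := sq.lift f' p w
  have := h.isIso hj d (sq.hom_ext (by rw [Category.assoc, hd, hf, hg])
    (by rw [Category.assoc, hd', h.w, hj.w])) hd'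
  exact sq.of_iso (asIso d).symm (Iso.refl _) (Iso.refl _) (Iso.refl _)
    (by simp [← hd]) (by simp [← hd']) (by simp) (by simp)

end IsConflation

end ExactStructure
namespace ExactStructure

variable {C : Type u} [Category.{v} C] [Preadditive C] {E : ExactStructure C}

/-! ### Vanishing of `Ext¹` -/

/-- The conflation ending in `𝟙 A` has zero first map; pushing it out along the zero map to `B`
gives a split conflation without using biproducts. It is the base point with which an arbitrary
extension is compared. -/
lemma exists_split_isConflation (A B : C) :
    ∃ (M : C) (i : B ⟶ M) (p : M ⟶ A) (r : M ⟶ B), E.IsConflation i p ∧ i ≫ r = 𝟙 B := by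
  obtain ⟨K, j, hj⟩ := E.id_deflation A
  have hj : E.IsConflation j (𝟙 A) := hj
  have hj0 : j = 0 := by simpa using hj.w
  obtain ⟨M, i, f, p, sq, -, h⟩ := hj.exists_pushout (0 : K ⟶ B)
  exact ⟨M, i, p, sq.desc 0 (𝟙 B) (by simp), h, sq.inr_desc _ _ _⟩

lemma subsingleton_ext1_iff {A B : C} :
    Subsingleton (E.Ext1 A B) ↔
      ∀ ⦃M : C⦄ (i : B ⟶ M) (p : M ⟶ A), E.IsConflation i p → ∃ r : M ⟶ B, i ≫ r = 𝟙 B := by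
  constructor
  · rintro ⟨hs⟩ M i p ⟨w, h⟩
    obtain ⟨M', i', p', r, ⟨w', h'⟩, hr⟩ := E.exists_split_isConflation A B
    obtain ⟨e, he, -⟩ := Quotient.exact (hs (Quotient.mk _ (⟨M, i, p, w, h⟩ : E.Extension A B))
      (Quotient.mk _ ⟨M', i', p', w', h'⟩))
    exact ⟨e.hom ≫ r, by rw [← Category.assoc, he, hr]⟩
  · intro H
    refine ⟨fun x y => ?_⟩
    induction x using Quotient.inductionOn with | _ S => ?_
    induction y using Quotient.inductionOn with | _ T => ?_
    have hS : E.IsConflation S.i S.p := ⟨S.w, S.conf⟩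
    have hT : E.IsConflation T.i T.p := ⟨T.w, T.conf⟩
    obtain ⟨r, hr⟩ := H _ _ hS
    obtain ⟨r', hr'⟩ := H _ _ hT
    obtain ⟨s, hs, hsr, h₁⟩ := hS.exists_section hr
    obtain ⟨s', hs', hsr', h₁'⟩ := hT.exists_section hr'
    -- Both middle terms decompose as `B ⊕ A` through the retractions `r`, `r'` and the sections
    -- `s`, `s'`; the isomorphism matches the summands.
    refine Quotient.sound ⟨⟨r ≫ T.i + S.p ≫ s', r' ≫ S.i + T.p ≫ s, ?_, ?_⟩, ?_, ?_⟩
    · simp [reassoc_of% hr', reassoc_of% hT.w, reassoc_of% hsr', reassoc_of% hs', h₁]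
    · simp [reassoc_of% hr, reassoc_of% hS.w, reassoc_of% hsr, reassoc_of% hs, h₁']
    · simp [reassoc_of% hr, reassoc_of% hS.w]
    · simp [hs', hT.w]

/-! ### Maps factoring through projective objects -/

lemma FactorsThruProj.comp_left {X Y Z : C} {f : Y ⟶ Z} (hf : E.FactorsThruProj f) (g : X ⟶ Y) :
    E.FactorsThruProj (g ≫ f) := by
  obtain ⟨P, a, b, hP, rfl⟩ := hf
  exact ⟨P, g ≫ a, b, hP, by simp⟩

lemma factorsThruProj_of_left {P Y : C} (hP : E.projectives P) (f : P ⟶ Y) :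
    E.FactorsThruProj f := ⟨P, 𝟙 P, f, hP, by simp⟩

lemma FactorsThruProj.exists_lift {X Y Z : C} {f : X ⟶ Z} (hf : E.FactorsThruProj f) {p : Y ⟶ Z}
    (hp : E.Deflation p) : ∃ g : X ⟶ Y, g ≫ p = f ∧ E.FactorsThruProj g := by
  obtain ⟨P, a, b, hP, rfl⟩ := hf
  obtain ⟨c, hc⟩ := E.proj_lift hP p hp b
  exact ⟨a ≫ c, by simp [hc], P, a, c, hP, rfl⟩

lemma projectives_of_retract {P X : C} (hP : E.projectives P) (a : X ⟶ P) (b : P ⟶ X)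
    (h : a ≫ b = 𝟙 X) : E.projectives X := by
  intro Y p hp
  obtain ⟨c, hc⟩ := E.proj_lift hP p hp b
  exact ⟨⟨⟨a ≫ c, by simp [hc, h]⟩⟩⟩

lemma projectives_of_factorsThruProj_id {X : C} (h : E.FactorsThruProj (𝟙 X)) :
    E.projectives X := by
  obtain ⟨P, a, b, hP, h⟩ := h
  exact projectives_of_retract hP a b h

/-! ### Maps induced on cokernels -/

section Induces

variable {D : Type u} [Category.{v} D]

/-- `h : X' ⟶ Y'` is induced by `f : X ⟶ Y` through a commutative diagram with rows
`X ⟶ I ⟶ X'` and `Y ⟶ J ⟶ Y'`. -/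
def Induces {X I X' Y J Y' : D} (i : X ⟶ I) (p : I ⟶ X') (j : Y ⟶ J) (q : J ⟶ Y')
    (f : X ⟶ Y) (h : X' ⟶ Y') : Prop :=
  ∃ g : I ⟶ J, i ≫ g = f ≫ j ∧ g ≫ q = p ≫ h

variable {X I X' Y J Y' Z L Z' : D} {i : X ⟶ I} {p : I ⟶ X'} {j : Y ⟶ J} {q : J ⟶ Y'}
  {m : Z ⟶ L} {n : L ⟶ Z'}

lemma induces_id : Induces i p i p (𝟙 X) (𝟙 X') := ⟨𝟙 _, by simp, by simp⟩

lemma Induces.comp {f : X ⟶ Y} {h : X' ⟶ Y'} {f' : Y ⟶ Z} {h' : Y' ⟶ Z'}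
    (H : Induces i p j q f h) (H' : Induces j q m n f' h') :
    Induces i p m n (f ≫ f') (h ≫ h') := by
  obtain ⟨g, hg₁, hg₂⟩ := H
  obtain ⟨g', hg₁', hg₂'⟩ := H'
  exact ⟨g ≫ g', by simp [reassoc_of% hg₁, hg₁'], by simp [hg₂', reassoc_of% hg₂]⟩

lemma Induces.sub [Preadditive D] {f f' : X ⟶ Y} {h h' : X' ⟶ Y'} (H : Induces i p j q f h)
    (H' : Induces i p j q f' h') : Induces i p j q (f - f') (h - h') := by
  obtain ⟨g, hg₁, hg₂⟩ := H
  obtain ⟨g', hg₁', hg₂'⟩ := H'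
  exact ⟨g - g', by simp [hg₁, hg₁'], by simp [hg₂', hg₂]⟩

end Induces

lemma IsConflation.exists_induces_left {X I X' Y J Y' : C} {i : X ⟶ I} {p : I ⟶ X'} {j : Y ⟶ J}
    {q : J ⟶ Y'} (h₁ : E.IsConflation i p) (h₂ : E.IsConflation j q) (hI : E.projectives I)
    (h : X' ⟶ Y') :
    ∃ f, Induces i p j q f h := by
  obtain ⟨g, hg⟩ := E.proj_lift hI q h₂.deflation (p ≫ h)
  obtain ⟨f, hf⟩ := h₂.exists_lift (i ≫ g) (by rw [Category.assoc, hg, reassoc_of% h₁.w, zero_comp])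
  exact ⟨f, g, hf.symm, hg⟩

/-! ### Frobenius categories: `Ext¹` and morphisms modulo projectives -/

section Frobenius

variable [E.IsFrobenius]

variable (E) in
lemma projectives_iff_injectives (X : C) : E.projectives X ↔ E.injectives X := by
  rw [IsFrobenius.projectives_eq_injectives (E := E)]

variable (E) in
lemma exists_projective_conflation (X : C) : ∃ (K P : C) (k : K ⟶ P) (q : P ⟶ X),
    E.IsConflation k q ∧ E.projectives P := by
  obtain ⟨P, q, ⟨K, k, h⟩, hP⟩ := IsFrobenius.enough_projectives (E := E) X
  exact ⟨K, P, k, q, h, hP⟩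

lemma FactorsThruProj.exists_extend {X Y Z : C} {f : X ⟶ Z} (hf : E.FactorsThruProj f) {i : X ⟶ Y}
    (hi : E.Inflation i) : ∃ g : Y ⟶ Z, i ≫ g = f ∧ E.FactorsThruProj g := by
  obtain ⟨P, a, b, hP, rfl⟩ := hf
  obtain ⟨c, hc⟩ := E.inj_extend ((E.projectives_iff_injectives P).1 hP) i hi a
  exact ⟨c ≫ b, by simp [reassoc_of% hc], P, c, b, hP, rfl⟩

section

variable {X I X' Y J Y' : C} {i : X ⟶ I} {p : I ⟶ X'} {j : Y ⟶ J} {q : J ⟶ Y'}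
  (h₁ : E.IsConflation i p) (h₂ : E.IsConflation j q)
include h₁ h₂

lemma IsConflation.exists_induces_right (hJ : E.projectives J) (f : X ⟶ Y) :
    ∃ h, Induces i p j q f h := by
  obtain ⟨g, hg⟩ := E.inj_extend ((E.projectives_iff_injectives J).1 hJ) i h₁.inflation (f ≫ j)
  obtain ⟨h, hh⟩ := h₁.exists_desc (g ≫ q) (by rw [reassoc_of% hg, h₂.w, comp_zero])
  exact ⟨h, g, hg, hh.symm⟩

/-- If `f` extends over `I` to a map `a`, then `g - a ≫ j` kills `X` and descends to a lift of `h`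
to `J`; the converse is dual. This gives both well-definedness and faithfulness of `Ω` and `Ω⁻¹` on
stable morphisms, for arbitrary choices of the conflations. -/
lemma Induces.factorsThruProj_iff (hI : E.projectives I) (hJ : E.projectives J)
    {f : X ⟶ Y} {h : X' ⟶ Y'} (H : Induces i p j q f h) :
    E.FactorsThruProj f ↔ E.FactorsThruProj h := by
  obtain ⟨g, hg₁, hg₂⟩ := H
  constructor
  · intro hf
    obtain ⟨a, ha, -⟩ := hf.exists_extend h₁.inflation
    obtain ⟨t, ht⟩ := h₁.exists_desc (g - a ≫ j) (by simp [reassoc_of% ha, hg₁])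
    have := h₁.epi
    refine ⟨J, t, q, hJ, ?_⟩
    simp [← cancel_epi p, reassoc_of% ht, hg₂, h₂.w]
  · intro hh
    obtain ⟨t, ht, -⟩ := hh.exists_lift h₂.deflation
    obtain ⟨a, ha⟩ := h₂.exists_lift (g - p ≫ t) (by simp [ht, hg₂])
    have := h₂.mono
    refine ⟨I, i, a, hI, ?_⟩
    simp [← cancel_mono j, ha, hg₁, reassoc_of% h₁.w]

end

/-- `Ext¹(A, B)` vanishes if and only if every map `ΩA ⟶ B` is stably zero. -/
lemma subsingleton_ext1_iff_of_projective {K P A B : C} {k : K ⟶ P} {q : P ⟶ A}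
    (h : E.IsConflation k q) (hP : E.projectives P) :
    Subsingleton (E.Ext1 A B) ↔ ∀ f : K ⟶ B, E.FactorsThruProj f := by
  rw [subsingleton_ext1_iff]
  constructor
  · intro H f
    obtain ⟨M, i, f', p, sq, -, hM⟩ := h.exists_pushout f
    obtain ⟨r, hr⟩ := H _ _ hM
    exact ⟨P, k, f' ≫ r, hP, by rw [reassoc_of% sq.w, hr, Category.comp_id]⟩
  · intro H M i p hM
    obtain ⟨f, g, hg₁, hg₂⟩ := h.exists_induces_left hM hP (𝟙 A)
    -- The comparison map `f` represents the class of the extension. Once it extends over `P`,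
    -- subtracting that extension from `g` leaves a map which descends to a section of `p`.
    obtain ⟨t, ht, -⟩ := (H f).exists_extend h.inflation
    obtain ⟨s, hs⟩ := h.exists_desc (g - t ≫ i) (by simp [hg₁, reassoc_of% ht])
    have := h.epi
    exact hM.exists_retraction (s := s) (by simp [← cancel_epi q, reassoc_of% hs, hg₂, hM.w])

/-- `Ext¹(A, B)` vanishes if and only if every map `A ⟶ Ω⁻¹B` is stably zero. -/
lemma subsingleton_ext1_iff_of_injective {B I Z A : C} {i : B ⟶ I} {p : I ⟶ Z}
    (h : E.IsConflation i p) (hI : E.projectives I) :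
    Subsingleton (E.Ext1 A B) ↔ ∀ f : A ⟶ Z, E.FactorsThruProj f := by
  obtain ⟨K, P, k, q, hK, hP⟩ := E.exists_projective_conflation A
  rw [subsingleton_ext1_iff_of_projective hK hP]
  constructor
  · intro H f
    obtain ⟨g, hg⟩ := hK.exists_induces_left h hP f
    exact (hg.factorsThruProj_iff hK h hP hI).1 (H g)
  · intro H f
    obtain ⟨g, hg⟩ := hK.exists_induces_right h hI f
    exact (hg.factorsThruProj_iff hK h hP hI).2 (H g)

/-- A stably zero map on `X` extends to a stably zero map on `Y`; subtracting it turns stable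
vanishing of `i ≫ m` into strict vanishing. This is exactness of the stable `Hom(-, T)` along a
conflation. -/
lemma IsConflation.exists_desc_stable {X Y Z T : C} {i : X ⟶ Y} {p : Y ⟶ Z}
    (h : E.IsConflation i p) (m : Y ⟶ T) (hm : E.FactorsThruProj (i ≫ m)) :
    ∃ n : Z ⟶ T, E.FactorsThruProj (m - p ≫ n) := by
  obtain ⟨m', hm', hf⟩ := hm.exists_extend h.inflation
  obtain ⟨n, hn⟩ := h.exists_desc (m - m') (by simp [hm'])
  exact ⟨n, by simpa [hn] using hf⟩

end Frobenius

end ExactStructure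
namespace ExactStructure

variable {C : Type u} [Category.{v} C] [Preadditive C] {E : ExactStructure C}
  [HasZeroObject C] [HasBinaryBiproducts C]

/-! ### Maps in the stable category -/

instance proj_additive : E.proj.Additive := CategoryTheory.Quotient.functor_additive _ _

lemma proj_map_eq_zero_iff {X Y : C} (f : X ⟶ Y) :
    E.proj.map f = 0 ↔ E.FactorsThruProj f := by
  rw [← E.proj.map_zero, CategoryTheory.Quotient.functor_map_eq_iff]
  change E.FactorsThruProj (f - 0) ↔ _
  rw [sub_zero]

lemma proj_map_eq_iff {X Y : C} (f g : X ⟶ Y) :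
    E.proj.map f = E.proj.map g ↔ E.FactorsThruProj (f - g) := by
  rw [← proj_map_eq_zero_iff, E.proj.map_sub, sub_eq_zero]

lemma isZero_proj_iff (X : C) : IsZero (E.proj.obj X) ↔ E.projectives X := by
  rw [IsZero.iff_id_eq_zero, ← E.proj.map_id, proj_map_eq_zero_iff]
  exact ⟨projectives_of_factorsThruProj_id, fun h => factorsThruProj_of_left h _⟩

variable [E.IsFrobenius]

lemma subsingleton_ext1_iff_hom {K P A B : C} {k : K ⟶ P} {q : P ⟶ A}
    (h : E.IsConflation k q) (hP : E.projectives P) :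
    Subsingleton (E.Ext1 A B) ↔ ∀ u : E.proj.obj K ⟶ E.proj.obj B, u = 0 := by
  simp only [subsingleton_ext1_iff_of_projective h hP, ← proj_map_eq_zero_iff]
  exact ⟨fun H u => by obtain ⟨u, rfl⟩ := E.proj.map_surjective u; exact H u, fun H u => H _⟩

lemma subsingleton_ext1_iff_hom' {B I Z A : C} {i : B ⟶ I} {p : I ⟶ Z}
    (h : E.IsConflation i p) (hI : E.projectives I) :
    Subsingleton (E.Ext1 A B) ↔ ∀ u : E.proj.obj A ⟶ E.proj.obj Z, u = 0 := by
  simp only [subsingleton_ext1_iff_of_injective h hI, ← proj_map_eq_zero_iff]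
  exact ⟨fun H u => by obtain ⟨u, rfl⟩ := E.proj.map_surjective u; exact H u, fun H u => H _⟩

/-! ### The suspension is fully faithful and essentially surjective -/

section

variable {X I X' Y J Y' : C} {i : X ⟶ I} {p : I ⟶ X'} {j : Y ⟶ J} {q : J ⟶ Y'}

variable (h₁ : E.IsConflation i p) (h₂ : E.IsConflation j q) (hI : E.projectives I)
  (hJ : E.projectives J)
include h₁ h₂ hI hJ

lemma Induces.proj_map_eq_iff {f f' : X ⟶ Y} {h h' : X' ⟶ Y'} (H : Induces i p j q f h)
    (H' : Induces i p j q f' h') :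
    E.proj.map f = E.proj.map f' ↔ E.proj.map h = E.proj.map h' := by
  rw [ExactStructure.proj_map_eq_iff, ExactStructure.proj_map_eq_iff]
  exact (H.sub H').factorsThruProj_iff h₁ h₂ hI hJ

lemma IsConflation.nonempty_iso_right (e : E.proj.obj X ≅ E.proj.obj Y) :
    Nonempty (E.proj.obj X' ≅ E.proj.obj Y') := by
  obtain ⟨f, hf⟩ := E.proj.map_surjective e.hom
  obtain ⟨g, hg⟩ := E.proj.map_surjective e.inv
  obtain ⟨f', hf'⟩ := h₁.exists_induces_right h₂ hJ f
  obtain ⟨g', hg'⟩ := h₂.exists_induces_right h₁ hI g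
  refine ⟨⟨E.proj.map f', E.proj.map g', ?_, ?_⟩⟩
  · rw [← E.proj.map_comp, ← E.proj.map_id,
      ← (hf'.comp hg').proj_map_eq_iff h₁ h₁ hI hI induces_id]
    simp [hf, hg]
  · rw [← E.proj.map_comp, ← E.proj.map_id,
      ← (hg'.comp hf').proj_map_eq_iff h₂ h₂ hJ hJ induces_id]
    simp [hf, hg]

lemma IsConflation.nonempty_iso_left (e : E.proj.obj X' ≅ E.proj.obj Y') :
    Nonempty (E.proj.obj X ≅ E.proj.obj Y) := by
  obtain ⟨f, hf⟩ := E.proj.map_surjective e.hom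
  obtain ⟨g, hg⟩ := E.proj.map_surjective e.inv
  obtain ⟨f', hf'⟩ := h₁.exists_induces_left h₂ hI f
  obtain ⟨g', hg'⟩ := h₂.exists_induces_left h₁ hJ g
  refine ⟨⟨E.proj.map f', E.proj.map g', ?_, ?_⟩⟩
  · rw [← E.proj.map_comp, ← E.proj.map_id,
      (hf'.comp hg').proj_map_eq_iff h₁ h₁ hI hI induces_id]
    simp [hf, hg]
  · rw [← E.proj.map_comp, ← E.proj.map_id,
      (hg'.comp hf').proj_map_eq_iff h₂ h₂ hJ hJ induces_id]
    simp [hf, hg]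

end

variable (E) in
lemma hull_isConflation (X : C) : E.IsConflation (E.hullι X) (E.hullπ X) :=
  ⟨_, E.hull_conflation X⟩

variable (E) in
lemma hull_projective (X : C) : E.projectives (E.hull X) :=
  (E.projectives_iff_injectives _).2 (E.hull_injective X)

/-- Frees computations with the suspension from the particular choice made in `suspHom`. -/
lemma susp_map_eq {X Y : C} {f : X ⟶ Y} {h : E.cosyzygy X ⟶ E.cosyzygy Y}
    (H : Induces (E.hullι X) (E.hullπ X) (E.hullι Y) (E.hullπ Y) f h) :
    E.susp.map (E.proj.map f) = E.proj.map h :=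
  (Induces.proj_map_eq_iff (E.hull_isConflation X) (E.hull_isConflation Y) (E.hull_projective X)
    (E.hull_projective Y) (E.suspHom_spec f) H).1 rfl

instance susp_full : E.susp.Full where
  map_surjective {X Y} h := by
    obtain ⟨X⟩ := X
    obtain ⟨Y⟩ := Y
    obtain ⟨h, rfl⟩ := E.proj.map_surjective (X := E.cosyzygy X) (Y := E.cosyzygy Y) h
    obtain ⟨f, hf⟩ := (E.hull_isConflation X).exists_induces_left (E.hull_isConflation Y)
      (E.hull_projective X) h
    exact ⟨E.proj.map f, susp_map_eq hf⟩

instance susp_faithful : E.susp.Faithful where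
  map_injective {X Y f g} h := by
    obtain ⟨X⟩ := X
    obtain ⟨Y⟩ := Y
    obtain ⟨f, rfl⟩ := E.proj.map_surjective (X := X) (Y := Y) f
    obtain ⟨g, rfl⟩ := E.proj.map_surjective (X := X) (Y := Y) g
    exact (Induces.proj_map_eq_iff (E.hull_isConflation X) (E.hull_isConflation Y)
      (E.hull_projective X) (E.hull_projective Y) (E.suspHom_spec f) (E.suspHom_spec g)).2 h

instance susp_preservesZeroMorphisms : E.susp.PreservesZeroMorphisms where
  map_zero X Y := by
    obtain ⟨X⟩ := X
    obtain ⟨Y⟩ := Y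
    have := susp_map_eq (E := E) (f := (0 : X ⟶ Y)) (h := 0) ⟨0, by simp, by simp⟩
    rwa [E.proj.map_zero, E.proj.map_zero] at this

lemma IsConflation.nonempty_susp_iso {X I Z : C} {i : X ⟶ I} {p : I ⟶ Z}
    (h : E.IsConflation i p) (hI : E.projectives I) :
    Nonempty (E.susp.obj (E.proj.obj X) ≅ E.proj.obj Z) :=
  (E.hull_isConflation X).nonempty_iso_right h (E.hull_projective X) hI (Iso.refl _)

instance susp_essSurj : E.susp.EssSurj where
  mem_essImage := by
    rintro ⟨X⟩
    obtain ⟨K, P, k, q, h, hP⟩ := E.exists_projective_conflation X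
    exact ⟨E.proj.obj K, h.nonempty_susp_iso hP⟩

/-! ### Exactness properties of triangles -/

/-- A pushout of a conflation with projective middle term gives a triangle. -/
lemma IsConflation.exists_isTriangle {K P Z M T : C} {k : K ⟶ P} {q : P ⟶ Z}
    (h : E.IsConflation k q) (hP : E.projectives P) {f : K ⟶ M} {f' : P ⟶ T} {i : M ⟶ T}
    (sq : IsPushout k f f' i) :
    ∃ δ : E.proj.obj T ⟶ E.susp.obj (E.proj.obj K),
      E.IsTriangle ⟨_, _, _, E.proj.map f, E.proj.map i, δ⟩ := by
  -- endomorphisms of the pushout which are the identity on `M` are stably the identity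
  have key : ∀ {P Z T : C} {k : K ⟶ P} {q : P ⟶ Z} (_ : E.IsConflation k q)
      (_ : E.projectives P) {f' : P ⟶ T} {i : M ⟶ T} (_ : IsPushout k f f' i)
      (d : T ⟶ T) (r : P ⟶ P), i ≫ d = i → f' ≫ d = r ≫ f' → k ≫ r = k →
      E.proj.map d = 𝟙 _ := by
    intro P Z T k q h hP f' i sq d r hd hd' hr
    obtain ⟨l, hl⟩ := h.exists_desc (r - 𝟙 P) (by simp [hr])
    rw [← E.proj.map_id, proj_map_eq_iff]
    refine ⟨P, sq.desc q 0 (by simp [h.w]) ≫ l, f', hP, sq.hom_ext ?_ ?_⟩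
    · simp [reassoc_of% hl, hd']
    · simp [hd]
  have hK := E.hull_isConflation K
  obtain ⟨W, v, j, w, sq', hj, hv⟩ := hK.exists_pushout f
  -- Extending the identity of `K` in both directions between `P` and the hull of `K` gives maps
  -- between the two pushouts; by `key` their composites are stably identities.
  obtain ⟨a, ha⟩ := E.inj_extend (E.hull_injective K) k h.inflation (E.hullι K)
  obtain ⟨b, hb⟩ := E.inj_extend ((E.projectives_iff_injectives P).1 hP) (E.hullι K)
    hK.inflation k
  let e : E.proj.obj W ≅ E.proj.obj T :=
    { hom := E.proj.map (sq'.desc (b ≫ f') i (by rw [reassoc_of% hb, sq.w]))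
      inv := E.proj.map (sq.desc (a ≫ j) v (by rw [reassoc_of% ha, sq'.w]))
      hom_inv_id := by
        rw [← E.proj.map_comp]
        exact key hK (E.hull_projective K) sq' _ (b ≫ a) (by simp) (by simp)
          (by simp [reassoc_of% hb, ha])
      inv_hom_id := by
        rw [← E.proj.map_comp]
        exact key h hP sq _ (a ≫ b) (by simp) (by simp) (by simp [reassoc_of% ha, hb]) }
  refine ⟨e.inv ≫ E.proj.map w, _, .mk f v j w sq'.flip hv.w hj,
    ⟨Iso.refl _, Iso.refl _, e, ?_, ?_, ?_⟩⟩
  · simp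
  · simp only [Iso.refl_hom, Category.id_comp]
    rw [← E.proj.map_comp]
    simp
  · simp only [Iso.refl_hom, E.susp.map_id]
    exact (Category.comp_id _).trans (e.hom_inv_id_assoc (E.proj.map w)).symm

lemma IsStandard.exists_isConflation {X Y W : C} {f : X ⟶ Y} {v : Y ⟶ W} {j : E.hull X ⟶ W}
    {w : W ⟶ E.cosyzygy X} (sq : IsPushout f (E.hullι X) v j) (hv : v ≫ w = 0)
    (hj : j ≫ w = E.hullπ X) : E.IsConflation v w :=
  (E.hull_isConflation X).of_isPushout sq.flip hj hv

/-- A commutative square between the first maps of two triangles extends to a morphism of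
triangles. -/
lemma IsTriangle.exists_hom {S T : E.StableTriangle} (hS : E.IsTriangle S) (hT : E.IsTriangle T)
    (a : S.obj₁ ⟶ T.obj₁) (b : S.obj₂ ⟶ T.obj₂) (comm : S.mor₁ ≫ b = a ≫ T.mor₁) :
    ∃ c : S.obj₃ ⟶ T.obj₃, S.mor₂ ≫ c = b ≫ T.mor₂ ∧
      S.mor₃ ≫ E.susp.map a = c ≫ T.mor₃ := by
  obtain ⟨S', hS', ⟨e⟩⟩ := hS
  obtain ⟨T', hT', ⟨e'⟩⟩ := hT
  have key : ∀ (a : S'.obj₁ ⟶ T'.obj₁) (b : S'.obj₂ ⟶ T'.obj₂),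
      S'.mor₁ ≫ b = a ≫ T'.mor₁ → ∃ c : S'.obj₃ ⟶ T'.obj₃, S'.mor₂ ≫ c = b ≫ T'.mor₂ ∧
      S'.mor₃ ≫ E.susp.map a = c ≫ T'.mor₃ := by
    obtain ⟨f, v, j, w, sq, hv, hj⟩ := hS'
    obtain ⟨f', v', j', w', sq', hv', hj'⟩ := hT'
    rename_i X Y W X' Y' W'
    intro a b comm
    obtain ⟨a, rfl⟩ := E.proj.map_surjective (X := X) (Y := X') a
    obtain ⟨b, rfl⟩ := E.proj.map_surjective (X := Y) (Y := Y') b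
    simp only [← E.proj.map_comp, proj_map_eq_iff] at comm
    -- The square commutes only up to a map through a projective. That error extends to `t` on the
    -- hull of `X`, and adding `t ≫ v'` on the hull makes the maps on `Y` and on the hull glue; the
    -- third square is unaffected because `v' ≫ w' = 0`.
    obtain ⟨t, ht, -⟩ := comm.exists_extend (E.hull_isConflation X).inflation
    obtain ⟨g, hg₁, hg₂⟩ := E.suspHom_spec a
    let c : W ⟶ W' := sq.desc (b ≫ v') (g ≫ j' + t ≫ v') (by
      simp [reassoc_of% hg₁, reassoc_of% ht, ← sq'.w])
    have hvc : v ≫ c = b ≫ v' := by simp [c]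
    have hjc : j ≫ c = g ≫ j' + t ≫ v' := by simp [c]
    have hc : w ≫ E.suspHom a = c ≫ w' := by
      apply sq.hom_ext
      · simp [reassoc_of% hv, reassoc_of% hvc, hv']
      · simp [reassoc_of% hj, reassoc_of% hjc, hj', hg₂, hv']
    refine ⟨E.proj.map c, ?_, ?_⟩
    · simp only [← E.proj.map_comp, hvc]
    · change E.proj.map w ≫ E.proj.map (E.suspHom a) = E.proj.map c ≫ E.proj.map w'
      rw [← E.proj.map_comp, ← E.proj.map_comp, hc]
  obtain ⟨c, hc₁, hc₂⟩ := key (e.iso₁.hom ≫ a ≫ e'.iso₁.inv) (e.iso₂.hom ≫ b ≫ e'.iso₂.inv) (by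
    have h₁ := e'.comm₁
    rw [← Iso.eq_comp_inv] at h₁
    rw [reassoc_of% e.comm₁, reassoc_of% comm]
    simp [h₁])
  refine ⟨e.iso₃.inv ≫ c ≫ e'.iso₃.hom, ?_, ?_⟩
  · have h₂ : S.mor₂ ≫ e.iso₃.inv = e.iso₂.inv ≫ S'.mor₂ := by
      rw [Iso.comp_inv_eq, Category.assoc, e.comm₂, Iso.inv_hom_id_assoc]
    rw [reassoc_of% h₂, reassoc_of% hc₁, e'.comm₂]
    simp
  · have h₃ : S.mor₃ = e.iso₃.inv ≫ S'.mor₃ ≫ E.susp.map e.iso₁.hom := by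
      rw [e.comm₃, Iso.inv_hom_id_assoc]
    have h₃' := e'.comm₃
    rw [h₃, Category.assoc, Category.assoc, ← E.susp.map_comp]
    have := congr(e.iso₃.inv ≫ $hc₂ ≫ E.susp.map e'.iso₁.hom)
    simp only [Category.assoc, ← E.susp.map_comp] at this
    simp only [Iso.inv_hom_id, Category.comp_id] at this
    rw [this, h₃']
    simp

/-- `Hom(-, Z)` is exact at the second object of a triangle. -/
lemma IsTriangle.exists_desc₂ {S : E.StableTriangle} (hS : E.IsTriangle S) {Z : E.Stable}
    (m : S.obj₂ ⟶ Z) (hm : S.mor₁ ≫ m = 0) : ∃ n : S.obj₃ ⟶ Z, S.mor₂ ≫ n = m := by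
  obtain ⟨S', hS', ⟨e⟩⟩ := hS
  have key : ∀ m : S'.obj₂ ⟶ Z, S'.mor₁ ≫ m = 0 → ∃ n : S'.obj₃ ⟶ Z, S'.mor₂ ≫ n = m := by
    obtain ⟨f, v, j, w, sq, hv, hj⟩ := hS'
    rename_i X Y W
    obtain ⟨Z⟩ := Z
    intro m hm
    obtain ⟨m, rfl⟩ := E.proj.map_surjective (X := Y) (Y := Z) m
    change E.proj.map f ≫ E.proj.map m = 0 at hm
    rw [← E.proj.map_comp, proj_map_eq_zero_iff] at hm
    obtain ⟨k, hk, -⟩ := hm.exists_extend (E.hull_isConflation X).inflation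
    refine ⟨E.proj.map (sq.desc m k hk.symm), ?_⟩
    simp only [← E.proj.map_comp]
    simp
  obtain ⟨n, hn⟩ := key (e.iso₂.hom ≫ m) (by rw [reassoc_of% e.comm₁, hm, comp_zero])
  refine ⟨e.iso₃.inv ≫ n, ?_⟩
  rw [← cancel_epi e.iso₂.hom, ← hn, ← reassoc_of% e.comm₂, Iso.hom_inv_id_assoc]

/-- `Hom(-, Z)` is exact at the third object of a triangle. -/
lemma IsTriangle.exists_desc₃ {S : E.StableTriangle} (hS : E.IsTriangle S) {Z : E.Stable}
    (m : S.obj₃ ⟶ Z) (hm : S.mor₂ ≫ m = 0) :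
    ∃ n : E.susp.obj S.obj₁ ⟶ Z, S.mor₃ ≫ n = m := by
  obtain ⟨S', hS', ⟨e⟩⟩ := hS
  have key : ∀ m : S'.obj₃ ⟶ Z, S'.mor₂ ≫ m = 0 →
      ∃ n : E.susp.obj S'.obj₁ ⟶ Z, S'.mor₃ ≫ n = m := by
    obtain ⟨f, v, j, w, sq, hv, hj⟩ := hS'
    rename_i X Y W
    obtain ⟨Z⟩ := Z
    intro m hm
    obtain ⟨m, rfl⟩ := E.proj.map_surjective (X := W) (Y := Z) m
    change E.proj.map v ≫ E.proj.map m = 0 at hm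
    rw [← E.proj.map_comp, proj_map_eq_zero_iff] at hm
    obtain ⟨n, hn⟩ := (IsStandard.exists_isConflation sq hv hj).exists_desc_stable m hm
    refine ⟨E.proj.map n, ?_⟩
    change E.proj.map w ≫ E.proj.map n = _
    rw [← E.proj.map_comp, eq_comm, proj_map_eq_iff]
    exact hn
  obtain ⟨n, hn⟩ := key (e.iso₃.hom ≫ m) (by rw [reassoc_of% e.comm₂, hm, comp_zero])
  refine ⟨E.susp.map e.iso₁.inv ≫ n, ?_⟩
  have h : S.mor₃ ≫ E.susp.map e.iso₁.inv = e.iso₃.inv ≫ S'.mor₃ := by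
    rw [← cancel_epi e.iso₃.hom, ← reassoc_of% e.comm₃, ← E.susp.map_comp]
    simp
  rw [reassoc_of% h, hn, Iso.inv_hom_id_assoc]

/-- `Hom(Z, -)` is exact at the second object of a triangle. -/
lemma IsTriangle.exists_lift₂ {S : E.StableTriangle} (hS : E.IsTriangle S) {Z : E.Stable}
    (z : Z ⟶ S.obj₂) (hz : z ≫ S.mor₂ = 0) : ∃ y : Z ⟶ S.obj₁, y ≫ S.mor₁ = z := by
  obtain ⟨S', hS', ⟨e⟩⟩ := hS
  have key : ∀ z : Z ⟶ S'.obj₂, z ≫ S'.mor₂ = 0 → ∃ y : Z ⟶ S'.obj₁, y ≫ S'.mor₁ = z := by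
    obtain ⟨f, v, j, w, sq, hv, hj⟩ := hS'
    rename_i X Y W
    obtain ⟨Z⟩ := Z
    intro z hz
    have hX := E.hull_isConflation X
    have hvw := IsStandard.exists_isConflation sq hv hj
    have := hvw.mono
    obtain ⟨z, rfl⟩ := E.proj.map_surjective (X := Z) (Y := Y) z
    change E.proj.map z ≫ E.proj.map v = 0 at hz
    rw [← E.proj.map_comp, proj_map_eq_zero_iff] at hz
    obtain ⟨P, a, b, hP, hab⟩ := hz
    -- Correcting `b` by `l ≫ j` moves it into the kernel `Y` of `w`, while `a ≫ l` lands in the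
    -- kernel `X` of `hullπ`. Thus `z` splits as `y ≫ f` plus a map through `P`.
    obtain ⟨l, hl⟩ := E.proj_lift hP (E.hullπ X) hX.deflation (b ≫ w)
    obtain ⟨c, hc⟩ := hvw.exists_lift (b - l ≫ j) (by simp [hj, hl])
    obtain ⟨y, hy⟩ := hX.exists_lift (a ≫ l) (by simp [hl, reassoc_of% hab, hv])
    refine ⟨E.proj.map y, ?_⟩
    change E.proj.map y ≫ E.proj.map f = _
    rw [← E.proj.map_comp, eq_comm, proj_map_eq_iff]
    refine ⟨P, a, c, hP, ?_⟩
    rw [← cancel_mono v]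
    simp [hc, hab, sq.w, reassoc_of% hy]
  obtain ⟨y, hy⟩ := key (z ≫ e.iso₂.inv) (by
    rw [← cancel_mono e.iso₃.hom, Category.assoc, e.comm₂]
    simp [hz])
  refine ⟨y ≫ e.iso₁.hom, ?_⟩
  rw [Category.assoc, ← e.comm₁, reassoc_of% hy]
  simp

/-- `Hom(Z, -)` is exact at the suspension of the first object of a triangle. -/
lemma IsTriangle.exists_lift₁ {S : E.StableTriangle} (hS : E.IsTriangle S) {Z : E.Stable}
    (z : Z ⟶ E.susp.obj S.obj₁) (hz : z ≫ E.susp.map S.mor₁ = 0) :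
    ∃ y : Z ⟶ S.obj₃, y ≫ S.mor₃ = z := by
  obtain ⟨S', hS', ⟨e⟩⟩ := hS
  have key : ∀ z : Z ⟶ E.susp.obj S'.obj₁, z ≫ E.susp.map S'.mor₁ = 0 →
      ∃ y : Z ⟶ S'.obj₃, y ≫ S'.mor₃ = z := by
    obtain ⟨f, v, j, w, sq, hv, hj⟩ := hS'
    rename_i X Y W
    obtain ⟨Z⟩ := Z
    intro z hz
    have hX := E.hull_isConflation X
    have hY := E.hull_isConflation Y
    have hvw := IsStandard.exists_isConflation sq hv hj
    obtain ⟨z, rfl⟩ := E.proj.map_surjective (X := Z) (Y := E.cosyzygy X) z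
    change E.proj.map z ≫ E.proj.map (E.suspHom f) = 0 at hz
    rw [← E.proj.map_comp, proj_map_eq_zero_iff] at hz
    obtain ⟨t, ht, -⟩ := hz.exists_lift hY.deflation
    obtain ⟨g, hg₁, hg₂⟩ := E.suspHom_spec f
    have hφ₁ : v ≫ sq.desc (E.hullι Y) g hg₁.symm = E.hullι Y := by simp
    have hφ₂ : sq.desc (E.hullι Y) g hg₁.symm ≫ E.hullπ Y = w ≫ E.suspHom f :=
      sq.hom_ext (by simp [hY.w, reassoc_of% hv]) (by simp [hg₂, reassoc_of% hj])
    set φ := sq.desc (E.hullι Y) g hg₁.symm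
    -- `W` is also the fibre product of the hull of `Y` and `Ω⁻¹X` over `Ω⁻¹Y`, so a lift of `z ≫
    -- suspHom f` to the hull is precisely what is needed to lift `z` to `W`.
    have hpb : IsPullback φ w (E.hullπ Y) (E.suspHom f) := hvw.isPullback hY hφ₁ hφ₂
    refine ⟨E.proj.map (hpb.lift t z ht), ?_⟩
    change E.proj.map _ ≫ E.proj.map w = _
    rw [← E.proj.map_comp]
    simp
  obtain ⟨y, hy⟩ := key (z ≫ E.susp.map e.iso₁.inv) (by
    have h : E.susp.map e.iso₁.inv ≫ E.susp.map S'.mor₁ =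
        E.susp.map S.mor₁ ≫ E.susp.map e.iso₂.inv := by
      have h' : e.iso₁.inv ≫ S'.mor₁ = S.mor₁ ≫ e.iso₂.inv := by
        rw [Iso.inv_comp_eq, ← reassoc_of% e.comm₁, Iso.hom_inv_id, Category.comp_id]
      rw [← E.susp.map_comp, ← E.susp.map_comp, h']
    rw [Category.assoc, h, reassoc_of% hz, zero_comp])
  refine ⟨y ≫ e.iso₃.hom, ?_⟩
  rw [Category.assoc, ← e.comm₃, reassoc_of% hy, ← E.susp.map_comp]
  simp

end ExactStructure
namespace ExactStructure

set_option linter.unusedSectionVars false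

variable {C : Type u} [Category.{v} C] [Preadditive C] {E : ExactStructure C}
  [HasZeroObject C] [HasBinaryBiproducts C] [E.IsFrobenius]

/-! ### Shifts of isomorphism closed full subcategories -/

section Shift

variable (S : ObjectProperty E.Stable) [S.IsClosedUnderIsomorphisms]

lemma shiftDown_iff (Z : E.Stable) : E.shiftDown S Z ↔ S (E.susp.obj Z) := by
  rw [shiftDown, S.isoClosure_eq_self]
  rfl

lemma shiftUp_shiftDown : E.shiftUp (E.shiftDown S) = S := by
  ext Z
  rw [shiftUp, ObjectProperty.prop_map_iff]
  constructor
  · rintro ⟨Y, hY, ⟨e⟩⟩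
    exact S.prop_of_iso e ((shiftDown_iff S Y).1 hY)
  · intro hZ
    exact ⟨E.susp.objPreimage Z, (shiftDown_iff S _).2
      (S.prop_of_iso (E.susp.objObjPreimageIso Z).symm hZ), ⟨E.susp.objObjPreimageIso Z⟩⟩

lemma shiftDown_shiftUp : E.shiftDown (E.shiftUp S) = S := by
  have : (E.shiftUp S).IsClosedUnderIsomorphisms := by unfold shiftUp; infer_instance
  ext Z
  rw [shiftDown_iff, shiftUp, ObjectProperty.prop_map_iff]
  constructor
  · rintro ⟨Y, hY, ⟨e⟩⟩
    exact S.prop_of_iso (E.susp.preimageIso e) hY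
  · intro hZ
    exact ⟨Z, hZ, ⟨Iso.refl _⟩⟩

end Shift

instance stableImage_isClosedUnderIsomorphisms (S : ObjectProperty C) :
    (E.stableImage S).IsClosedUnderIsomorphisms := by
  unfold stableImage; infer_instance

lemma stableImage_iff (S : ObjectProperty C) (Z : E.Stable) :
    E.stableImage S Z ↔ ∃ X, S X ∧ Nonempty (E.proj.obj X ≅ Z) := by
  rw [stableImage, ObjectProperty.prop_map_iff]

/-! ### Stable invariance of `Ext¹` -/

lemma subsingleton_ext1_of_iso_left {A A' B : C} (e : E.proj.obj A ≅ E.proj.obj A')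
    (h : Subsingleton (E.Ext1 A B)) : Subsingleton (E.Ext1 A' B) := by
  rw [subsingleton_ext1_iff_hom' (E.hull_isConflation B) (E.hull_projective B)] at h ⊢
  intro u
  rw [← cancel_epi e.hom, h (e.hom ≫ u), comp_zero]

lemma subsingleton_ext1_of_iso_right {A B B' : C} (e : E.proj.obj B ≅ E.proj.obj B')
    (h : Subsingleton (E.Ext1 A B)) : Subsingleton (E.Ext1 A B') := by
  obtain ⟨K, P, k, q, hK, hP⟩ := E.exists_projective_conflation A
  rw [subsingleton_ext1_iff_hom hK hP] at h ⊢
  intro u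
  rw [← cancel_mono e.inv, h (u ≫ e.inv), zero_comp]

lemma subsingleton_ext1_of_projective {A B : C} (hA : E.projectives A) :
    Subsingleton (E.Ext1 A B) := by
  rw [subsingleton_ext1_iff_of_injective (E.hull_isConflation B) (E.hull_projective B)]
  exact fun f => factorsThruProj_of_left hA f

lemma IsConflation.nonempty_iso_of_projective {X Y Z : C} {i : X ⟶ Y} {p : Y ⟶ Z}
    (h : E.IsConflation i p) (hZ : E.projectives Z) :
    Nonempty (E.proj.obj X ≅ E.proj.obj Y) := by
  obtain ⟨r, hr⟩ := h.exists_retraction_of_projective hZ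
  obtain ⟨s, hs, hsr, h₁⟩ := h.exists_section hr
  refine ⟨E.proj.map i, E.proj.map r, ?_, ?_⟩
  · rw [← E.proj.map_comp, hr, E.proj.map_id]
  · rw [← E.proj.map_comp, ← E.proj.map_id, eq_comm, proj_map_eq_iff, ← h₁, add_sub_cancel_left]
    exact ⟨Z, p, s, hZ, rfl⟩

/-! ### Cotorsion pairs -/

namespace IsCotorsionPair

variable {F T : ObjectProperty C} (hFT : E.IsCotorsionPair F T)
include hFT

lemma left_iff (X : C) : F X ↔ ∀ Y, T Y → Subsingleton (E.Ext1 X Y) :=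
  iff_of_eq (congrFun hFT.left_eq X)

lemma right_iff (Y : C) : T Y ↔ ∀ X, F X → Subsingleton (E.Ext1 X Y) :=
  iff_of_eq (congrFun hFT.right_eq Y).symm

lemma left_of_iso {X X' : C} (e : E.proj.obj X ≅ E.proj.obj X') (hX : F X) : F X' := by
  rw [hFT.left_iff] at hX ⊢
  exact fun Y hY => subsingleton_ext1_of_iso_left e (hX Y hY)

lemma right_of_iso {Y Y' : C} (e : E.proj.obj Y ≅ E.proj.obj Y') (hY : T Y) : T Y' := by
  rw [hFT.right_iff] at hY ⊢
  exact fun X hX => subsingleton_ext1_of_iso_right e (hY X hX)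

lemma stableImage_left_iff (X : C) : E.stableImage F (E.proj.obj X) ↔ F X := by
  rw [stableImage_iff]
  exact ⟨fun ⟨_, h, ⟨e⟩⟩ => hFT.left_of_iso e h, fun h => ⟨X, h, ⟨Iso.refl _⟩⟩⟩

lemma stableImage_right_iff (Y : C) : E.stableImage T (E.proj.obj Y) ↔ T Y := by
  rw [stableImage_iff]
  exact ⟨fun ⟨_, h, ⟨e⟩⟩ => hFT.right_of_iso e h, fun h => ⟨Y, h, ⟨Iso.refl _⟩⟩⟩

/-- A stable isomorphism of syzygies induces one of the objects they come from, and `F` is closed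
under stable isomorphism. So any one conflation with projective middle term tests membership in `𝒳`.
-/
lemma stableImage_syzygies_iff {K P X : C} {k : K ⟶ P} {q : P ⟶ X} (h : E.IsConflation k q)
    (hP : E.projectives P) : E.stableImage (E.syzygies F) (E.proj.obj K) ↔ F X := by
  rw [stableImage_iff]
  constructor
  · rintro ⟨K', ⟨X', P', k', q', w', hX', hP', h'⟩, ⟨e⟩⟩
    obtain ⟨e'⟩ := IsConflation.nonempty_iso_right ⟨w', h'⟩ h hP' hP e
    exact hFT.left_of_iso e' hX'
  · exact fun hX => ⟨K, ⟨X, P, k, q, h.w, hX, hP, h.choose_spec⟩, ⟨Iso.refl _⟩⟩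

/-- Both orthogonality conditions are those of the cotorsion pair, read through the equivalence of
`Ext¹(X, Y) = 0` with `Hom(ΩX, Y) = 0`. -/
lemma isHomOrthogonalPair :
    E.IsHomOrthogonalPair (E.stableImage (E.syzygies F)) (E.stableImage T) where
  right_eq := by
    ext ⟨Y⟩
    refine Iff.trans ?_ (hFT.stableImage_right_iff Y).symm
    rw [hFT.right_iff]
    constructor
    · intro H X hX
      obtain ⟨K, P, k, q, h, hP⟩ := E.exists_projective_conflation X
      rw [subsingleton_ext1_iff_hom h hP]
      exact fun u => H u ((hFT.stableImage_syzygies_iff h hP).2 hX)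
    · rintro H ⟨K⟩ u hK
      have h := E.hull_isConflation K
      have hX := (hFT.stableImage_syzygies_iff h (E.hull_projective K)).1 hK
      exact (subsingleton_ext1_iff_hom h (E.hull_projective K)).1 (H _ hX) u
  left_eq := by
    ext ⟨K⟩
    have h := E.hull_isConflation K
    refine (hFT.stableImage_syzygies_iff h (E.hull_projective K)).trans ?_
    rw [hFT.left_iff]
    constructor
    · rintro H ⟨Y⟩ u hY
      exact (subsingleton_ext1_iff_hom h (E.hull_projective K)).1
        (H _ ((hFT.stableImage_right_iff Y).1 hY)) u
    · intro H Y hY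
      rw [subsingleton_ext1_iff_hom h (E.hull_projective K)]
      exact fun u => H u ((hFT.stableImage_right_iff Y).2 hY)

lemma hom_eq_zero {A B : E.Stable} (hA : E.stableImage (E.syzygies F) A)
    (hB : E.stableImage T B) (u : A ⟶ B) : u = 0 := by
  rw [← hFT.isHomOrthogonalPair.right_eq] at hB
  exact hB u hA

lemma left_of_projective {P : C} (hP : E.projectives P) : F P := by
  rw [hFT.left_iff]
  exact fun _ _ => subsingleton_ext1_of_projective hP

lemma right_of_projective {P : C} (hP : E.projectives P) : T P := by
  rw [hFT.right_iff]
  intro X _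
  rw [subsingleton_ext1_iff]
  intro M i p h
  obtain ⟨⟨r⟩⟩ := (E.projectives_iff_injectives P).1 hP i h.inflation
  exact ⟨r.retraction, r.id⟩

lemma left_of_isConflation {X Y Z : C} {i : X ⟶ Y} {p : Y ⟶ Z} (h : E.IsConflation i p)
    (hX : F X) (hZ : F Z) : F Y := by
  rw [hFT.left_iff] at hX hZ ⊢
  intro A hA
  have hA' := E.hull_isConflation A
  rw [subsingleton_ext1_iff_of_injective hA' (E.hull_projective A)]
  intro u
  obtain ⟨n, hn⟩ := h.exists_desc_stable u
    ((subsingleton_ext1_iff_of_injective hA' (E.hull_projective A)).1 (hX A hA) _)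
  have := ((subsingleton_ext1_iff_of_injective hA' (E.hull_projective A)).1 (hZ A hA) n)
  simpa using E.factors_add hn (this.comp_left p)

lemma left_of_retract {X Y : C} (hY : F Y) (a : X ⟶ Y) (b : Y ⟶ X) (hab : a ≫ b = 𝟙 X) :
    F X := by
  rw [hFT.left_iff] at hY ⊢
  intro A hA
  have hA' := E.hull_isConflation A
  rw [subsingleton_ext1_iff_of_injective hA' (E.hull_projective A)]
  intro u
  have := (subsingleton_ext1_iff_of_injective hA' (E.hull_projective A)).1 (hY A hA) (b ≫ u)
  simpa [reassoc_of% hab] using this.comp_left a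

/-! ### Completeness and approximation triangles -/

/-- Approximate `K = ΩM` by a triangle `A ⟶ K ⟶ B` and push `K ⟶ P ⟶ M` out along `K ⟶ B`. Morally
the pushout `X` is the cone `A[1]`, hence in `F`. The proof avoids identifying the two: a map `X ⟶
Ω⁻¹Y` with `Y` in `T` is shown to be stably zero from `Hom(A, Y) = 0` and the exactness of `Hom` on
the triangle. -/
lemma exists_left_of_hasApproximations
    (hA : E.HasApproximations (E.stableImage (E.syzygies F)) (E.stableImage T)) (M : C) :
    ∃ (Y X : C) (i : Y ⟶ X) (p : X ⟶ M), T Y ∧ F X ∧ E.IsConflation i p := by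
  obtain ⟨K, P, k, q, hK, hP⟩ := E.exists_projective_conflation M
  obtain ⟨A, ⟨B⟩, f, g, δ, hA, hB, htr⟩ := hA (E.proj.obj K)
  obtain ⟨g, rfl⟩ := E.proj.map_surjective (X := K) (Y := B) g
  obtain ⟨X, v, j, w, sq, hjw, hv⟩ := hK.exists_pushout g
  refine ⟨B, X, v, w, (hFT.stableImage_right_iff B).1 hB, ?_, hv⟩
  rw [hFT.left_iff]
  intro Y hY
  have hY' := E.hull_isConflation Y
  rw [subsingleton_ext1_iff_of_injective hY' (E.hull_projective Y)]
  intro u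
  -- `u` factors through `w` in the stable category
  have hvu : E.proj.map (v ≫ u) = 0 := by
    obtain ⟨n, hn⟩ := htr.exists_desc₃ (Z := E.susp.obj (E.proj.obj Y)) (E.proj.map (v ≫ u)) (by
      change E.proj.map g ≫ E.proj.map (v ≫ u) = 0
      rw [← E.proj.map_comp, proj_map_eq_zero_iff]
      exact ⟨P, k, j ≫ u, hP, by rw [reassoc_of% sq.w]⟩)
    obtain ⟨n, rfl⟩ := E.susp.map_surjective n
    rw [← hn, hFT.hom_eq_zero hA ((hFT.stableImage_right_iff Y).2 hY) n, Functor.map_zero]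
    exact comp_zero
  obtain ⟨d, hd⟩ := hv.exists_desc_stable u ((proj_map_eq_zero_iff _).1 hvu)
  -- `d` comes from a map `K ⟶ Y`, which factors through `g` in the stable category
  obtain ⟨d', γ, hγ₁, hγ₂⟩ := hK.exists_induces_left hY' hP d
  obtain ⟨e, he⟩ := htr.exists_desc₂ (E.proj.map d')
    (hFT.hom_eq_zero hA ((hFT.stableImage_right_iff Y).2 hY) _)
  obtain ⟨e, rfl⟩ := E.proj.map_surjective (X := B) (Y := Y) e
  have he : E.proj.map g ≫ E.proj.map e = E.proj.map d' := he
  rw [← E.proj.map_comp, eq_comm, proj_map_eq_iff] at he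
  -- The difference `d' - g ≫ e` extends to `t` on `P`. With `γ` corrected by `t`, the maps from `P`
  -- and `B` to the hull of `Y` agree on `K` and glue to a lift of `w ≫ d` to that hull.
  obtain ⟨t, ht, -⟩ := he.exists_extend hK.inflation
  have hwd : E.FactorsThruProj (w ≫ d) := by
    refine ⟨E.hull Y, sq.desc (γ - t ≫ E.hullι Y) (e ≫ E.hullι Y) ?_, E.hullπ Y,
      E.hull_projective Y, ?_⟩
    · simp [hγ₁, reassoc_of% ht]
    · apply sq.hom_ext
      · simp [hγ₂, hY'.w, reassoc_of% hjw]
      · simp [hY'.w, reassoc_of% hv.w]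
  simpa using E.factors_add hd hwd

lemma isCompleteCotorsionPair_of_hasApproximations
    (hA : E.HasApproximations (E.stableImage (E.syzygies F)) (E.stableImage T)) :
    E.IsCompleteCotorsionPair F T where
  toIsCotorsionPair := hFT
  exists_left M := by
    obtain ⟨Y, X, i, p, hY, hX, w, h⟩ := hFT.exists_left_of_hasApproximations hA M
    exact ⟨Y, X, i, p, w, hY, hX, h⟩
  exists_right M := by
    have hM := E.hull_isConflation M
    obtain ⟨Y, X, i, p, hY, hX, h⟩ := hFT.exists_left_of_hasApproximations hA (E.cosyzygy M)
    -- Salce's trick: the pullback is an extension of a projective object by `Y`, hence stably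
    -- isomorphic to `Y` and in `T`, and it is also an extension of `X` by `M`.
    obtain ⟨Y', i', f', p', sq, -, h'⟩ := h.exists_pullback (E.hullπ M)
    obtain ⟨w, hc⟩ : E.IsConflation (sq.lift 0 (E.hullι M) (by simp [hM.w])) f' :=
      hM.of_isPullback sq.flip (by simp) (by simp)
    obtain ⟨e⟩ := h'.nonempty_iso_of_projective (E.hull_projective M)
    exact ⟨Y', X, _, f', w, hFT.right_of_iso e hY, hX, hc⟩

end IsCotorsionPair

lemma IsCompleteCotorsionPair.hasApproximations {F T : ObjectProperty C}
    (hFT : E.IsCompleteCotorsionPair F T) :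
    E.HasApproximations (E.stableImage (E.syzygies F)) (E.stableImage T) := by
  rintro ⟨M⟩
  obtain ⟨Y, X, i, p, w, hY, hX, h⟩ := hFT.exists_right M
  have h : E.IsConflation i p := ⟨w, h⟩
  obtain ⟨K, P, k, q, hK, hP⟩ := E.exists_projective_conflation X
  -- The comparison over the identity of `X` exhibits `Y` as the pushout of `P` along `K ⟶ M`, that
  -- is, as a cone of `ΩX ⟶ M`.
  obtain ⟨f, g, hg₁, hg₂⟩ := hK.exists_induces_left h hP (𝟙 X)
  obtain ⟨δ, hδ⟩ := hK.exists_isTriangle hP (hK.isPushout h hg₁ (by simpa using hg₂))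
  exact ⟨_, _, _, _, δ, (hFT.stableImage_syzygies_iff hK hP).2 hX,
    (hFT.stableImage_right_iff Y).2 hY, hδ⟩

/-! ### The conditions for a complete cotorsion pair -/

namespace IsCotorsionPair

variable {F T : ObjectProperty C} (hFT : E.IsCotorsionPair F T)
include hFT

/-- An object `X` of `F ⊓ T` gives the approximation `ΩX ⟶ 0 ⟶ X` of zero, and so does the zero
object. Comparing third terms makes `X` stably zero. -/
lemma projectives_of_approximationsUnique
    (hU : E.ApproximationsUnique (E.stableImage (E.syzygies F)) (E.stableImage T)) :
    F ⊓ T = E.projectives := by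
  ext X
  refine ⟨?_, fun hX => ⟨hFT.left_of_projective hX, hFT.right_of_projective hX⟩⟩
  rintro ⟨hX, hX'⟩
  have hz : E.projectives (0 : C) := E.projectives_zero
  -- approximations of zero: from the objects of `F ⊓ T`
  have key : ∀ X : C, F X → T X → ∃ (A : E.Stable) (f : A ⟶ E.proj.obj 0)
      (g : E.proj.obj 0 ⟶ E.proj.obj X) (δ : E.proj.obj X ⟶ E.susp.obj A),
      E.IsApproximation (E.stableImage (E.syzygies F)) (E.stableImage T) f g δ := by
    intro X hX hX'
    obtain ⟨K, P, k, q, hK, hP⟩ := E.exists_projective_conflation X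
    have h0 : E.IsConflation (0 : (0 : C) ⟶ X) (𝟙 X) := by
      obtain ⟨L, l, hl⟩ := E.id_deflation X
      have hl : E.IsConflation l (𝟙 X) := hl
      have : l = 0 := by simpa using hl.w
      have := hl.mono
      have hL : IsZero L := by
        rw [IsZero.iff_id_eq_zero, ← cancel_mono l]
        simp_all
      exact hl.of_iso (hL.iso (isZero_zero C)) (Iso.refl _) (Iso.refl _) (by simp_all) (by simp)
    obtain ⟨δ, hδ⟩ := hK.exists_isTriangle hP (f := (0 : K ⟶ 0)) (f' := q) (i := 0)
      (hK.isPushout h0 (by simp [hK.w]) (by simp))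
    exact ⟨_, _, _, δ, (hFT.stableImage_syzygies_iff hK hP).2 hX,
      (hFT.stableImage_right_iff X).2 hX', hδ⟩
  obtain ⟨A, f, g, δ, h⟩ := key X hX hX'
  obtain ⟨A', f', g', δ', h'⟩ := key 0 (hFT.left_of_projective hz) (hFT.right_of_projective hz)
  obtain ⟨e⟩ := hU f g δ f' g' δ' h h'
  exact (isZero_proj_iff X).1 (((isZero_proj_iff (E := E) 0).2 hz).of_iso e.iso₃)

lemma cohereditary_iff :
    E.Cohereditary F ↔ ∀ A, E.stableImage (E.syzygies F) A →
      E.stableImage (E.syzygies F) (E.susp.obj A) := by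
  constructor
  · rintro hF ⟨A⟩ hA
    have h := E.hull_isConflation A
    have hX := (hFT.stableImage_syzygies_iff h (E.hull_projective A)).1 hA
    have h' := E.hull_isConflation (E.cosyzygy A)
    exact (hFT.stableImage_syzygies_iff h' (E.hull_projective _)).2
      (hF _ ⟨_, _, _, _, h'.w, hX, E.hull_injective _, E.hull_conflation _⟩)
  · rintro H Z ⟨X, I, i, p, w, hX, hI, h⟩
    obtain ⟨K, P, k, q, hK, hP⟩ := E.exists_projective_conflation X
    obtain ⟨e⟩ := hK.nonempty_susp_iso hP
    have hI' := (E.projectives_iff_injectives I).2 hI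
    exact (hFT.stableImage_syzygies_iff ⟨w, h⟩ hI').1 (ObjectProperty.prop_of_iso _ e
      (H _ ((hFT.stableImage_syzygies_iff hK hP).2 hX)))

lemma hereditary_iff :
    E.Hereditary F ↔ ∀ A, E.stableImage (E.syzygies F) (E.susp.obj A) →
      E.stableImage (E.syzygies F) A := by
  constructor
  · rintro hF ⟨A⟩ hA
    rw [stableImage_iff] at hA
    obtain ⟨K, hK, ⟨e⟩⟩ := hA
    exact (hFT.stableImage_syzygies_iff (E.hull_isConflation A) (E.hull_projective A)).2
      (hFT.left_of_iso e (hF _ hK))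
  · rintro H Z hZ
    obtain ⟨K, P, k, q, hK, hP⟩ := E.exists_projective_conflation Z
    obtain ⟨e⟩ := hK.nonempty_susp_iso hP
    refine (hFT.stableImage_syzygies_iff hK hP).1 (H _ (ObjectProperty.prop_of_iso _ e.symm ?_))
    exact (stableImage_iff _ _).2 ⟨Z, hZ, ⟨Iso.refl _⟩⟩

/-- Orthogonality and the exactness of `Hom` give comparison morphisms in both directions over `M`.
An endomorphism of `A` or `B` compatible with `M` differs from the identity by a map which, after
suspension in the case of `A`, factors through a map `A[1] ⟶ B`. That map is zero because `A[1]` is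
again in `𝒳`. -/
lemma approximationsUniqueOver (hF : E.Cohereditary F) :
    E.ApproximationsUniqueOver (E.stableImage (E.syzygies F)) (E.stableImage T) := by
  rw [hFT.cohereditary_iff] at hF
  -- morphisms between approximations
  have key : ∀ ⦃M A B A' B' : E.Stable⦄ (f : A ⟶ M) (g : M ⟶ B) (h : B ⟶ E.susp.obj A)
      (f' : A' ⟶ M) (g' : M ⟶ B') (h' : B' ⟶ E.susp.obj A'),
      E.IsApproximation (E.stableImage (E.syzygies F)) (E.stableImage T) f g h →
      E.IsApproximation (E.stableImage (E.syzygies F)) (E.stableImage T) f' g' h' →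
      ∃ (a : A ⟶ A') (c : B ⟶ B'), a ≫ f' = f ∧ g ≫ c = g' ∧ h ≫ E.susp.map a = c ≫ h' := by
    rintro M A B A' B' f g h f' g' h' ⟨hA, hB, H⟩ ⟨hA', hB', H'⟩
    obtain ⟨a, ha⟩ := H'.exists_lift₂ f (hFT.hom_eq_zero hA hB' _)
    obtain ⟨c, hc₁, hc₂⟩ := H.exists_hom H' a (𝟙 M) ((Category.comp_id _).trans ha.symm)
    exact ⟨a, c, ha, hc₁.trans (Category.id_comp _), hc₂⟩
  have uniq₁ : ∀ ⦃M A B : E.Stable⦄ (f : A ⟶ M) (g : M ⟶ B) (h : B ⟶ E.susp.obj A),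
      E.IsApproximation (E.stableImage (E.syzygies F)) (E.stableImage T) f g h →
      ∀ a : A ⟶ A, a ≫ f = f → a = 𝟙 A := by
    rintro M A B f g h ⟨hA, hB, H⟩ a ha
    obtain ⟨y, hy⟩ := H.exists_lift₁ (E.susp.map (a - 𝟙 A)) (by
      rw [← E.susp.map_comp]
      simp [ha])
    rw [hFT.hom_eq_zero (hF _ hA) hB y, zero_comp] at hy
    rw [← sub_eq_zero]
    exact E.susp.map_injective (hy.symm.trans (E.susp.map_zero _ _).symm)
  have uniq₂ : ∀ ⦃M A B : E.Stable⦄ (f : A ⟶ M) (g : M ⟶ B) (h : B ⟶ E.susp.obj A),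
      E.IsApproximation (E.stableImage (E.syzygies F)) (E.stableImage T) f g h →
      ∀ c : B ⟶ B, g ≫ c = g → c = 𝟙 B := by
    rintro M A B f g h ⟨hA, hB, H⟩ c hc
    obtain ⟨y, hy⟩ := H.exists_desc₃ (c - 𝟙 B) (by simp [hc])
    rw [hFT.hom_eq_zero (hF _ hA) hB y, comp_zero] at hy
    exact sub_eq_zero.1 hy.symm
  intro M A B A' B' f g h f' g' h' H H'
  obtain ⟨a, c, ha, hc, hac⟩ := key f g h f' g' h' H H'
  obtain ⟨a', c', ha', hc', -⟩ := key f' g' h' f g h H' H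
  refine ⟨⟨⟨a, a', ?_, ?_⟩, Iso.refl M, ⟨c, c', ?_, ?_⟩, ?_, ?_, ?_⟩, rfl⟩
  · exact uniq₁ f g h H _ (by rw [Category.assoc, ha', ha])
  · exact uniq₁ f' g' h' H' _ (by rw [Category.assoc, ha, ha'])
  · exact uniq₂ f g h H _ (by rw [reassoc_of% hc, hc'])
  · exact uniq₂ f' g' h' H' _ (by rw [reassoc_of% hc', hc])
  · exact (Category.comp_id _).trans ha.symm
  · exact hc.trans (Category.id_comp _).symm
  · exact hac

lemma isTStructure_iff :
    E.IsTStructure (E.shiftDown (E.stableImage (E.syzygies F))) (E.stableImage T) ↔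
      E.IsCompleteCotorsionPair F T ∧ E.Cohereditary F := by
  constructor
  · rintro ⟨-, -, h₁, h₂⟩
    rw [shiftUp_shiftDown] at h₁ h₂
    refine ⟨hFT.isCompleteCotorsionPair_of_hasApproximations h₂, ?_⟩
    exact hFT.cohereditary_iff.2 fun A hA => (shiftDown_iff _ A).1 (h₁ A hA)
  · rintro ⟨h₁, h₂⟩
    refine ⟨by unfold shiftDown; infer_instance, ?_, ?_, ?_⟩
    · rw [shiftUp_shiftDown]
      exact hFT.isHomOrthogonalPair
    · rw [shiftUp_shiftDown]
      exact fun A hA => (shiftDown_iff _ A).2 (hFT.cohereditary_iff.1 h₂ A hA)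
    · rw [shiftUp_shiftDown]
      exact h₁.hasApproximations

end IsCotorsionPair

/-- Take `Y ⟶ X' ⟶ Z` with `Y` in `T`, `X'` in `F`, and pull it back along `I ⟶ Z` to `G`. As an
extension of `X'` by `X`, `G` is in `F`; as an extension of the projective `I` by `Y`, it has `Y` as
a summand. So `Y` lies in `F ⊓ T` and is projective, hence injective. Then `X' ⟶ Z` splits and `Z`
is a retract of `X'`. -/
lemma IsCompleteCotorsionPair.cohereditary_of_inf_eq {F T : ObjectProperty C}
    (hFT : E.IsCompleteCotorsionPair F T) (h : F ⊓ T = E.projectives) : E.Cohereditary F := by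
  rintro Z ⟨X, I, i, p, w, hX, hI, hi⟩
  have hi : E.IsConflation i p := ⟨w, hi⟩
  have hI := (E.projectives_iff_injectives I).2 hI
  obtain ⟨Y, X', j, q, w', hY, hX', hj⟩ := hFT.exists_left Z
  have hj : E.IsConflation j q := ⟨w', hj⟩
  obtain ⟨G, j', f', q', sq, -, hG⟩ := hj.exists_pullback p
  have hG' : E.IsConflation (sq.lift 0 i (by simp [hi.w])) f' :=
    hi.of_isPullback sq.flip (by simp) (by simp)
  obtain ⟨r, hr⟩ := hG.exists_retraction_of_projective hI
  have hYF : F Y := hFT.left_of_retract (hFT.left_of_isConflation hG' hX hX') j' r hr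
  have hYP : E.projectives Y := h ▸ (⟨hYF, hY⟩ : (F ⊓ T) Y)
  obtain ⟨⟨s⟩⟩ := (E.projectives_iff_injectives Y).1 hYP j hj.inflation
  obtain ⟨t, ht, -⟩ := hj.exists_section s.id
  exact hFT.left_of_retract hX' t q ht

/-! ### The bijections -/

lemma IsCotorsionPair.tfae {F T : ObjectProperty C} (hFT : E.IsCotorsionPair F T) :
    List.TFAE
      [E.IsCompleteCotorsionPair F T ∧ F ⊓ T = E.projectives,
       E.IsCompleteCotorsionPair F T ∧ E.Cohereditary F,
       E.HasApproximations (E.stableImage (E.syzygies F)) (E.stableImage T) ∧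
         E.ApproximationsUnique (E.stableImage (E.syzygies F)) (E.stableImage T),
       E.HasApproximations (E.stableImage (E.syzygies F)) (E.stableImage T) ∧
         E.ApproximationsUniqueOver (E.stableImage (E.syzygies F)) (E.stableImage T),
       E.IsTStructure (E.shiftDown (E.stableImage (E.syzygies F))) (E.stableImage T)] := by
  tfae_have 1 → 2 := fun ⟨h₁, h₂⟩ => ⟨h₁, h₁.cohereditary_of_inf_eq h₂⟩
  tfae_have 2 → 4 := fun ⟨h₁, h₂⟩ => ⟨h₁.hasApproximations, hFT.approximationsUniqueOver h₂⟩
  tfae_have 4 → 3 := fun ⟨h₁, h₂⟩ => ⟨h₁, fun _ _ _ _ _ _ _ _ _ _ _ h h' =>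
    ⟨(h₂ _ _ _ _ _ _ h h').choose⟩⟩
  tfae_have 3 → 1 := fun ⟨h₁, h₂⟩ => ⟨hFT.isCompleteCotorsionPair_of_hasApproximations h₁,
    hFT.projectives_of_approximationsUnique h₂⟩
  tfae_have 5 ↔ 2 := hFT.isTStructure_iff
  tfae_finish

lemma shiftDown_stableImage_syzygies (F : ObjectProperty C) :
    E.shiftDown (E.stableImage (E.syzygies F)) =
      E.stableImage (E.syzygies (E.syzygies F)) := by
  ext ⟨Z⟩
  rw [shiftDown_iff, stableImage_iff, stableImage_iff]
  constructor
  · rintro ⟨K, hK, ⟨e⟩⟩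
    obtain ⟨L, P, k, q, h, hP⟩ := E.exists_projective_conflation K
    exact ⟨L, ⟨K, P, k, q, h.w, hK, hP, h.choose_spec⟩,
      h.nonempty_iso_left (E.hull_isConflation Z) hP (E.hull_projective Z) e⟩
  · rintro ⟨L, ⟨K, P, k, q, w, hK, hP, h⟩, ⟨e⟩⟩
    exact ⟨K, hK, IsConflation.nonempty_iso_right ⟨w, h⟩ (E.hull_isConflation Z) hP
      (E.hull_projective Z) e⟩

/-- Here `𝒳` is stable under both shifts. With `Z ≅ K[1]`, the object `Z` is in `F` iff `K` is in
`𝒳`, iff `Z[1] ≅ K[2]` is. -/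
lemma IsCotorsionPair.shiftDown_stableImage_syzygies_eq {F T : ObjectProperty C}
    (hFT : E.IsCotorsionPair F T) (h₁ : E.Hereditary F) (h₂ : E.Cohereditary F) :
    E.shiftDown (E.stableImage (E.syzygies F)) = E.stableImage F := by
  ext ⟨Z⟩
  rw [shiftDown_iff]
  refine Iff.trans ?_ (hFT.stableImage_left_iff Z).symm
  obtain ⟨K, P, k, q, hK, hP⟩ := E.exists_projective_conflation Z
  obtain ⟨e⟩ := hK.nonempty_susp_iso hP
  rw [← hFT.stableImage_syzygies_iff hK hP]
  rw [hFT.hereditary_iff] at h₁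
  rw [hFT.cohereditary_iff] at h₂
  exact ⟨fun H => h₁ _ (ObjectProperty.prop_of_iso _ e.symm (h₁ _ H)),
    fun H => h₂ _ (ObjectProperty.prop_of_iso _ e (h₂ _ H))⟩

/-- A Hom-orthogonal pair in the stable category comes from a cotorsion pair. -/
lemma IsHomOrthogonalPair.exists_isCotorsionPair {X Y : ObjectProperty E.Stable}
    (h : E.IsHomOrthogonalPair X Y) :
    ∃ F T : ObjectProperty C, E.IsCotorsionPair F T ∧ E.stableImage (E.syzygies F) = X ∧
      E.stableImage T = Y := by
  have hYc : Y.IsClosedUnderIsomorphisms := by rw [← h.right_eq]; infer_instance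
  have hY : E.stableImage (Y.inverseImage E.proj) = Y := by
    ext ⟨Z⟩
    rw [stableImage_iff]
    exact ⟨fun ⟨_, hX, ⟨e⟩⟩ => Y.prop_of_iso e hX, fun hZ => ⟨Z, hZ, ⟨Iso.refl _⟩⟩⟩
  have hFT : E.IsCotorsionPair (E.leftExtOrthogonal (Y.inverseImage E.proj))
      (Y.inverseImage E.proj) := by
    refine ⟨?_, rfl⟩
    ext Z
    constructor
    · intro hZ
      change Y (E.proj.obj Z)
      rw [← h.right_eq]
      rintro ⟨A⟩ u hA
      -- For `A` in `X`, the cosyzygy of `A` lies in the left class, since its `Ext¹` into `B`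
      -- vanishes together with `Hom(A, B)`. Orthogonality of `Z` to it then gives `Hom(A, Z) = 0`.
      have hA' := E.hull_isConflation A
      refine (subsingleton_ext1_iff_hom hA' (E.hull_projective A)).1 (hZ _ fun B hB => ?_) u
      rw [subsingleton_ext1_iff_hom hA' (E.hull_projective A)]
      rw [h.left_eq] at hA
      exact fun u => hA u hB
    · exact fun hZ X hX => hX Z hZ
  refine ⟨_, _, hFT, ?_, hY⟩
  rw [hFT.isHomOrthogonalPair.left_eq, hY, h.left_eq]

lemma IsCotorsionPair.ext_of_stableImage {F T F' T' : ObjectProperty C}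
    (hFT : E.IsCotorsionPair F T) (hFT' : E.IsCotorsionPair F' T')
    (h : E.stableImage T = E.stableImage T') : F = F' ∧ T = T' := by
  have hT : T = T' := by
    ext Y
    rw [← hFT.stableImage_right_iff, h, hFT'.stableImage_right_iff]
  exact ⟨by rw [hFT.left_eq, hFT'.left_eq, hT], hT⟩

lemma IsTStructure.exists_isCotorsionPair {U V : ObjectProperty E.Stable}
    (h : E.IsTStructure U V) : ∃ F T : ObjectProperty C, E.IsCotorsionPair F T ∧
      E.shiftDown (E.stableImage (E.syzygies F)) = U ∧ E.stableImage T = V := by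
  obtain ⟨F, T, hFT, hF, hT⟩ := h.orthogonal.exists_isCotorsionPair
  have := h.closed
  exact ⟨F, T, hFT, by rw [hF, shiftDown_shiftUp], hT⟩

/-- For cones: a standard cone of `X ⟶ Y` is an extension of `Ω⁻¹X` by `Y`, and `F` is closed under
extensions and cosyzygies. -/
lemma IsCotorsionPair.isTriangulatedSubcategory {F T : ObjectProperty C}
    (hFT : E.IsCotorsionPair F T) (h₁ : E.Hereditary F) (h₂ : E.Cohereditary F) :
    E.IsTriangulatedSubcategory (E.stableImage F) where
  closed := inferInstance
  zero := ⟨E.proj.obj 0, (isZero_proj_iff 0).2 E.projectives_zero,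
    (hFT.stableImage_left_iff 0).2 (hFT.left_of_projective E.projectives_zero)⟩
  shift_eq := by
    have h := hFT.shiftDown_stableImage_syzygies_eq h₁ h₂
    rw [← h, shiftUp_shiftDown]
    ext A
    rw [shiftDown_iff]
    exact ⟨hFT.hereditary_iff.1 h₁ A, hFT.cohereditary_iff.1 h₂ A⟩
  cone := by
    rintro T' ⟨S, hS, ⟨e⟩⟩ hX hY
    have hX' := ObjectProperty.prop_of_iso _ e.iso₁.symm hX
    have hY' := ObjectProperty.prop_of_iso _ e.iso₂.symm hY
    refine ObjectProperty.prop_of_iso _ e.iso₃ ?_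
    obtain ⟨f, v, j, w, sq, hv, hj⟩ := hS
    rename_i X Y W
    rw [hFT.stableImage_left_iff] at hX' hY' ⊢
    exact hFT.left_of_isConflation (IsStandard.exists_isConflation sq hv hj) hY'
      (h₂ _ ⟨X, _, _, _, _, hX', E.hull_injective X, E.hull_conflation X⟩)

end ExactStructure

theorem mainTheorem6 {C : Type u} [Category.{v} C] [Preadditive C] [HasZeroObject C]
    [HasBinaryBiproducts C] (E : ExactStructure C) [E.IsFrobenius] :
    -- the equivalent conditions for a cotorsion pair `(F, T)`
    (∀ F T : ObjectProperty C, E.IsCotorsionPair F T →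
      List.TFAE
        [E.IsCompleteCotorsionPair F T ∧ F ⊓ T = E.projectives,
         E.IsCompleteCotorsionPair F T ∧ E.Cohereditary F,
         E.HasApproximations (E.stableImage (E.syzygies F)) (E.stableImage T) ∧
           E.ApproximationsUnique (E.stableImage (E.syzygies F)) (E.stableImage T),
         E.HasApproximations (E.stableImage (E.syzygies F)) (E.stableImage T) ∧
           E.ApproximationsUniqueOver (E.stableImage (E.syzygies F)) (E.stableImage T),
         E.IsTStructure (E.shiftDown (E.stableImage (E.syzygies F))) (E.stableImage T)]) ∧
    -- complete cohereditary cotorsion pairs and t-structures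
    (∀ F T : ObjectProperty C, E.IsCompleteCotorsionPair F T → E.Cohereditary F →
      E.shiftDown (E.stableImage (E.syzygies F)) =
        E.stableImage (E.syzygies (E.syzygies F))) ∧
    Set.BijOn
      (fun p : ObjectProperty C × ObjectProperty C =>
        (E.shiftDown (E.stableImage (E.syzygies p.1)), E.stableImage p.2))
      {p | E.IsCompleteCotorsionPair p.1 p.2 ∧ E.Cohereditary p.1}
      {q | E.IsTStructure q.1 q.2} ∧
    -- complete hereditary and cohereditary cotorsion pairs and Bousfield localizing pairs
    (∀ F T : ObjectProperty C, E.IsCompleteCotorsionPair F T → E.Hereditary F →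
      E.Cohereditary F →
      E.shiftDown (E.stableImage (E.syzygies F)) = E.stableImage F) ∧
    Set.BijOn
      (fun p : ObjectProperty C × ObjectProperty C =>
        (E.shiftDown (E.stableImage (E.syzygies p.1)), E.stableImage p.2))
      {p | E.IsCompleteCotorsionPair p.1 p.2 ∧ E.Hereditary p.1 ∧ E.Cohereditary p.1}
      {q | E.IsBousfieldLocalizingPair q.1 q.2} := by
  refine ⟨fun F T hFT => hFT.tfae, fun F T _ _ => ExactStructure.shiftDown_stableImage_syzygies F,
    ⟨?_, ?_, ?_⟩, fun F T hFT h₁ h₂ => hFT.shiftDown_stableImage_syzygies_eq h₁ h₂, ⟨?_, ?_, ?_⟩⟩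
  · rintro ⟨F, T⟩ ⟨h₁, h₂⟩
    exact h₁.isTStructure_iff.2 ⟨h₁, h₂⟩
  · rintro ⟨F, T⟩ ⟨h₁, -⟩ ⟨F', T'⟩ ⟨h₁', -⟩ h
    -- The second components suffice: `T` is recovered from its stable image, and `F` from `T`.
    exact Prod.ext_iff.2 (h₁.ext_of_stableImage h₁'.toIsCotorsionPair (Prod.ext_iff.1 h).2)
  · rintro ⟨U, V⟩ h
    obtain ⟨F, T, hFT, rfl, rfl⟩ := ExactStructure.IsTStructure.exists_isCotorsionPair h
    exact ⟨(F, T), hFT.isTStructure_iff.1 h, rfl⟩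
  · rintro ⟨F, T⟩ ⟨h₁, h₂, h₃⟩
    refine ⟨h₁.isTStructure_iff.2 ⟨h₁, h₃⟩, ?_⟩
    change E.IsTriangulatedSubcategory (E.shiftDown (E.stableImage (E.syzygies F)))
    rw [h₁.shiftDown_stableImage_syzygies_eq h₂ h₃]
    exact h₁.isTriangulatedSubcategory h₂ h₃
  · rintro ⟨F, T⟩ ⟨h₁, -⟩ ⟨F', T'⟩ ⟨h₁', -⟩ h
    exact Prod.ext_iff.2 (h₁.ext_of_stableImage h₁'.toIsCotorsionPair (Prod.ext_iff.1 h).2)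
  · rintro ⟨U, V⟩ ⟨h, h'⟩
    obtain ⟨F, T, hFT, rfl, rfl⟩ := h.exists_isCotorsionPair
    obtain ⟨h₁, h₂⟩ := hFT.isTStructure_iff.1 h
    refine ⟨(F, T), ⟨h₁, hFT.hereditary_iff.2 fun A hA => ?_, h₂⟩, rfl⟩
    -- For `U = 𝒳[-1]`, the condition `U = U[1]` reads `𝒳[-1] = 𝒳`, which contains the closure under
    -- `[-1]` that expresses being hereditary.
    have : E.shiftDown _ = E.shiftUp _ := h'.shift_eq
    rw [ExactStructure.shiftUp_shiftDown] at this
    rw [← this, ExactStructure.shiftDown_iff]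
    exact hA
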